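/- Let $\mathfrak g$ be a finite-dimensional simple real Lie algebra with a Lie algebra grading $\mathfrak g=\mathfrak g_{-1}\oplus\mathfrak g_0\oplus\mathfrak g_{+1}$, $\mathfrak g_{-1}\neq 0$ (so that $G_+=\exp\mathfrak g_{+1}$ is Abelian). Let $(t^a)_{a\in I}$ be a basis of homogeneous elements, $I_-$ the set of indices of grade $-1$ (denoted $\alpha$), and $J_a$ the coordinate functions on $\mathfrak g$ dual to $t^a$. Let $\eta^{ab}=\mathrm{tr}_R(t^at^b)$ be the trace form of a finite-dimensional representation $R$ for which it is non-degenerate, $\eta_{ab}$ its inverse, $t_a=\eta_{ab}t^b$, $[t_a,t_b]=f_{ab}^c\,t_c$, and equip the field $\mathbb R(J)$ of rational functions of the $J_a$ with the Lie–Poisson bracket, i.e. the biderivation with $\{J_a,J_b\}=f_{ab}^c J_c$. Put $J_{tot}=\sum_{a}J_a t^a$ and $\tilde t^-=\sum_{\alpha\in I_-}J_\alpha t^\alpha$, elements of $\mathbb R(J)\otimes\mathfrak g$. (a) There are $\tilde t^0\in\mathfrak g_0$ and $\tilde t^+\in\mathfrak g_{+1}$ with coefficients in $\mathbb R(J_\alpha)$,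 the field of rational functions of the $J_\alpha$ ($\alpha\in I_-$) only, such that $[\tilde t^0,\tilde t^\pm]=\pm\tilde t^\pm$ and $[\tilde t^+,\tilde t^-]=2\tilde t^0\neq 0$. (b) For every such $\mathfrak{sl}(2)$ there is a basis $(\tilde\ell^s)_{s\in I_{hw}}$ of the space of highest weight vectors $\{x:[\tilde t^+,x]=0\}$ with coefficients in $\mathbb R(J_\alpha)$. For every such basis there are a unique $c\in\mathbb R(J)\otimes\mathfrak g_{+1}$ and unique $\tilde W_s\in\mathbb R(J)$ such that, with $g=\exp c$, $$g^{-1}J_{tot}\,g=e^{-\mathrm{ad}\,c}J_{tot}=\tilde t^-+\sum_{s}\tilde W_s\,\tilde\ell^s .$$ (c) Each $\tilde W_s$ is a quotient of a polynomial in the $J_a$ by a nonzero polynomial in the $J_\alpha$ only. The set $\mathcal W$ of all rational functions $P(\tilde W_s,J_\alpha)/Q(J_\alpha)$, with $P,Q$ real polynomials and $Q\ne0$, is closed under the Poisson bracket, and it is exactly the set of quotients $P(J_a)/Q(J_\alpha)$ with $Q\neq0$ and $P$ a polynomial on $\mathfrak g$ invariant under conjugation by $G_+$ (the "enlarged" finite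 $W$-algebra). (d) The functions $J_\alpha$, $\alpha\in I_-$, lie in the center of $\mathcal W$: they belong to $\mathcal W$ and $\{J_\alpha,f\}=0$ for all $f\in\mathcal W$. -/

import Mathlib

open scoped TensorProduct

noncomputable section

namespace EnlargedW

/-- A Lie algebra grading `g = g₋₁ ⊕ g₀ ⊕ g₊₁` over `ℤ`; all other pieces vanish. -/
structure ThreeGrading (g : Type*) [LieRing g] [LieAlgebra ℝ g] where
  space : ℤ → Submodule ℝ g
  isInternal : DirectSum.IsInternal space
  lie_mem : ∀ i j : ℤ, ∀ x ∈ space i, ∀ y ∈ space j, ⁅x, y⁆ ∈ space (i + j)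
  eq_bot : ∀ i : ℤ, 1 < |i| → space i = ⊥

/-- Conjugation `X ↦ g⁻¹ X g` by `g = exp c`, that is `exp (-ad c)`, for `ad`-nilpotent `c`. -/
def conjExp (k : Type*) {L : Type*} [Field k] [Algebra ℚ k] [LieRing L] [LieAlgebra k L] (c : L) :
    L →ₗ[k] L :=
  letI : Module ℚ (L →ₗ[k] L) := Module.compHom _ (algebraMap ℚ k)
  IsNilpotent.exp (-(LieAlgebra.ad k L c) : Module.End k L)

section Functions

variable (ι : Type*)

/-- Rational functions over `ℝ` in the coordinates `J_a`, `a : ι`. -/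
abbrev RatFun := FractionRing (MvPolynomial ι ℝ)

variable {ι}

/-- A polynomial in the `J_a`, as a rational function. -/
def ofPoly (P : MvPolynomial ι ℝ) : RatFun ι := algebraMap (MvPolynomial ι ℝ) (RatFun ι) P

/-- The coordinate function `J_a`. -/
def coordJ (a : ι) : RatFun ι := ofPoly (MvPolynomial.X a)

/-- The partial derivative `∂f/∂J_a` of a rational function (quotient rule). -/
def partialJ (a : ι) (f : RatFun ι) : RatFun ι :=
  let p := IsFractionRing.num (MvPolynomial ι ℝ) f
  let q : MvPolynomial ι ℝ := IsFractionRing.den (MvPolynomial ι ℝ) f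
  ofPoly (MvPolynomial.pderiv a p * q - p * MvPolynomial.pderiv a q) / ofPoly (q ^ 2)

/-- The indices `α ∈ I₋`, of grade `-1`. -/
abbrev Neg (d : ι → ℤ) := {a : ι // d a = -1}

/-- A polynomial in the `J_α`, `α ∈ I₋`, as a rational function. -/
def ofNegPoly (d : ι → ℤ) (Q : MvPolynomial (Neg d) ℝ) : RatFun ι :=
  MvPolynomial.aeval (fun α : Neg d => coordJ α.1) Q

/-- Quotients `P(J_α)/Q(J_α)`: rational functions of the `J_α`, `α ∈ I₋`, only. -/
def negRational (d : ι → ℤ) : Set (RatFun ι) :=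
  {f | ∃ P Q : MvPolynomial (Neg d) ℝ, Q ≠ 0 ∧ f = ofNegPoly d P / ofNegPoly d Q}

/-- Quotients `P(J_a)/Q(J_α)`: polynomials in all `J_a` over polynomials in the `J_α` only. -/
def polyOverNeg (d : ι → ℤ) : Set (RatFun ι) :=
  {f | ∃ (P : MvPolynomial ι ℝ) (Q : MvPolynomial (Neg d) ℝ), Q ≠ 0 ∧
    f = ofPoly P / ofNegPoly d Q}

/-- The algebra of rational functions `P(W_s, J_α)/Q(J_α)` attached to a family `W`. -/
def wAlgebra (d : ι → ℤ) {S : Type*} (W : S → RatFun ι) : Set (RatFun ι) :=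
  {f | ∃ (P : MvPolynomial (S ⊕ Neg d) ℝ) (Q : MvPolynomial (Neg d) ℝ), Q ≠ 0 ∧
    f = MvPolynomial.aeval (Sum.elim W fun α => coordJ α.1) P / ofNegPoly d Q}

end Functions

section Poisson

variable {ι g : Type*} [Fintype ι] [DecidableEq ι] [LieRing g] [LieAlgebra ℝ g]
  (V : Type*) [AddCommGroup V] [Module ℝ V] [LieRingModule g V] [LieModule ℝ g V]
  (t : Module.Basis ι ℝ g)

/-- The metric `η^{ab} = ⟨t^a, t^b⟩ = tr_V (t^a t^b)`. -/
def metric : Matrix ι ι ℝ := Matrix.of fun a b => LieModule.traceForm ℝ g V (t a) (t b)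

/-- `t_a = η_{ab} t^b`, with `η_{ab}` the inverse of the metric. -/
def lowered (a : ι) : g := ∑ b, (metric V t)⁻¹ a b • t b

/-- `f_{ab}^c = ⟨[t_a, t_b], t^c⟩`, which is `η_{ad} η_{be} η^{cg} f^{de}_g`. -/
def structLow (a b c : ι) : ℝ := LieModule.traceForm ℝ g V ⁅lowered V t a, lowered V t b⁆ (t c)

/-- The Lie–Poisson bracket on rational functions, with `{J_a, J_b} = f_{ab}^c J_c`. -/
def poisson (f h : RatFun ι) : RatFun ι :=
  ∑ a, ∑ b, partialJ a f * partialJ b h *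
    ∑ c, algebraMap ℝ (RatFun ι) (structLow V t a b c) * coordJ c

end Poisson

section Generic

variable {ι g : Type*} [Fintype ι] [LieRing g] [LieAlgebra ℝ g]
  (t : Module.Basis ι ℝ g) (d : ι → ℤ)

/-- The full matrix `J_tot = J_a t^a`. -/
def jTot : RatFun ι ⊗[ℝ] g := ∑ a, coordJ a ⊗ₜ[ℝ] t a

/-- `t̃⁻ = J_α t^α`, the grade `-1` part of `J_tot`. -/
def tMinus : RatFun ι ⊗[ℝ] g := ∑ α : Neg d, coordJ α.1 ⊗ₜ[ℝ] t α.1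

/-- The coefficients of `x` on the `t^a` are rational functions of the `J_α` only. -/
def HasNegCoeffs (x : RatFun ι ⊗[ℝ] g) : Prop :=
  ∀ a, (t.baseChange (RatFun ι)).repr x a ∈ negRational d

/-- `{t̃⁻, t̃⁰, t̃⁺}` is an `sl(2)` containing `t̃⁻ = J_α t^α`, compatible with the grading, with
coefficients depending on the `J_α` only; `[t̃⁰, t̃^±] = ± t̃^±` and `[t̃⁺, t̃⁻] = 2 t̃⁰`. -/
structure IsNegSl2 (𝒢 : ThreeGrading g) (t0 tp : RatFun ι ⊗[ℝ] g) : Prop where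
  triple : IsSl2Triple ((2 : RatFun ι) • t0) tp (tMinus t d)
  zero_mem : t0 ∈ (𝒢.space 0).baseChange (RatFun ι)
  plus_mem : tp ∈ (𝒢.space 1).baseChange (RatFun ι)
  zero_coeffs : HasNegCoeffs t d t0
  plus_coeffs : HasNegCoeffs t d tp

/-- `ℓ` is a basis of the space of highest weight vectors `[t̃⁺, ℓ] = 0`, with coefficients
depending on the `J_α` only. -/
structure IsHwBasis {S : Type*} (tp : RatFun ι ⊗[ℝ] g) (ℓ : S → RatFun ι ⊗[ℝ] g) : Prop where
  linearIndependent : LinearIndependent (RatFun ι) ℓ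
  span_eq : Submodule.span (RatFun ι) (Set.range ℓ) =
    LinearMap.ker (LieAlgebra.ad (RatFun ι) (RatFun ι ⊗[ℝ] g) tp : Module.End (RatFun ι) (RatFun ι ⊗[ℝ] g))
  coeffs : ∀ s, HasNegCoeffs t d (ℓ s)

/-- `c` in `g₊₁` (over the rational functions) conjugates `J_tot` into the highest weight form
`J_α t^α + W_s ℓ^s`. -/
def IsHwForm {S : Type*} [Fintype S] (𝒢 : ThreeGrading g) (ℓ : S → RatFun ι ⊗[ℝ] g)
    (c : RatFun ι ⊗[ℝ] g) (W : S → RatFun ι) : Prop :=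
  c ∈ (𝒢.space 1).baseChange (RatFun ι) ∧
    conjExp (RatFun ι) c (jTot t) = tMinus t d + ∑ s, W s • ℓ s

/-- A polynomial function `P(J_a)` on `g` is invariant under conjugation by `G₊ = exp g₊₁`. -/
def IsInvariant (𝒢 : ThreeGrading g) (P : MvPolynomial ι ℝ) : Prop :=
  ∀ x ∈ 𝒢.space 1, ∀ X : g,
    MvPolynomial.eval (fun a => t.repr (conjExp ℝ x X) a) P =
      MvPolynomial.eval (fun a => t.repr X a) P

end Generic

end EnlargedW

end

/-! Write `k = ℝ(J)`, `K = ℝ(J_α)`, `f = t̃⁻`. The grading of `k ⊗ g` is the eigenspace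
decomposition of `ad h` for some `h` in `g`, since derivations of a Killing Lie algebra are inner
(`ThreeGrading.exists_gradingElement`).

Genericity of `f` enters through one fact: `ad f` is injective on degree `1`
(`lie_gradedPart_injective`). If `[f, y] = 0`, applying `∂/∂J_α` and then bracketing with `y` gives
`[y, [y, t^α]] = 0` for all `α`; hence `(ad y)² = 0`, and `y` lies in the radical of the Killing
form. Killing orthogonality yields `e` of degree `1` with `[f, [f, e]] = f`
(`IsGradingElement.exists_lie_lie_eq`), and injectivity makes a multiple of `e` complete an
`sl(2)`-triple (`isSl2Triple_of_lie_lie`).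

With `e` now denoting `t̃⁺`, degree reasons give `[e, e^{-ad c} J_tot - f] = [e, J₀] - [e, [c, f]]`,
where `J₀` is the degree `0` part of `J_tot`. Reaching highest weight form is therefore a linear
condition on `c`, and `c ↦ [e, [c, f]]` is bijective on degree `1` (`eq_zero_of_lie_lie_triple`,
`exists_lie_lie_triple`). This determines `c`, and then `W`.

The rest exploits this uniqueness. A `K`-linear projection of `k` onto a subalgebra containing `K`
and the `J_a` fixes `c` and `W`, which locates `W` (`HwSetting.form_mem`). The substitution `J ↦
e^{-ad x} J` with `x` in `g₊₁` fixes `K` and carries one form of `J_tot` to another, hence fixes `W`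
(`HwSetting.algHom_form`). Conversely, an invariant polynomial may be evaluated on the highest
weight form, so it is a polynomial in `W` over `K` (`HwSetting.aeval_mem`). The substitution
preserves the Poisson bracket (`poisson_conjFun`), so its invariants are closed under it. Finally
`{J_α, ·}` is the infinitesimal action of an element of `g₊₁`, which kills `K` and `W`
(`HwSetting.derivation_form`). -/

open scoped TensorProduct

noncomputable section

namespace EnlargedW

/-! ### Nilpotency of a product of two operators. -/

section NilpotentProduct

variable {k E : Type*} [Field k] [CharZero k] [AddCommGroup E] [Module k E]

/-- If `A ^ 3 = 0` and `A` commutes with `[A, B]`, then `[A, B]` is nilpotent. -/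
theorem commutator_pow_eq_zero {R : Type*} [Ring R] [Module ℚ R] {A B C : R} (hA : A ^ 3 = 0)
    (hC : A * B = B * A + C) (hAC : A * C = C * A) : C ^ 7 = 0 := by
  have hC' : ∀ x, A * (B * x) = B * (A * x) + C * x := fun x => by
    rw [← mul_assoc, hC, add_mul, mul_assoc]
  have hCA : C * A = A * C := hAC.symm
  have hCA' : ∀ x, C * (A * x) = A * (C * x) := fun x => by
    rw [← mul_assoc, hCA, mul_assoc]
  have hA' : A * (A * A) = 0 := by rw [← hA]; noncomm_ring
  have hdiv : ∀ (n : ℕ) (x : R), n ≠ 0 → n • x = 0 → x = 0 := by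
    intro n x hn hx
    rw [← Nat.cast_smul_eq_nsmul ℚ] at hx
    exact (smul_eq_zero_iff_right (Nat.cast_ne_zero.mpr hn)).mp hx
  -- Commuting `A³ = 0` with `B` gives `3 A²C = 0`.
  have h2 : A * (A * C) = 0 := by
    have h1 : A * (A * A) * B = B * (A * (A * A)) + 3 • (A * (A * C)) := by
      simp only [mul_assoc, hC, hC', hCA, hCA', mul_add]
      abel
    rw [hA', zero_mul, mul_zero, zero_add] at h1
    exact hdiv 3 _ (by norm_num) h1.symm
  -- Commute `A²C = 0` with `B`, then multiply by `C` so that the term containing `A²` dies.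
  have h4 : A * (C * (C * C)) = 0 := by
    have h1 : A * (A * C) * B - B * (A * (A * C)) =
        2 • (A * (C * C)) + A * (A * (C * B - B * C)) := by
      simp only [mul_assoc, hC', hCA', mul_add, mul_sub]
      abel
    have h3 : C * (2 • (A * (C * C)) + A * (A * (C * B - B * C))) =
        2 • (A * (C * (C * C))) + A * (A * C) * (C * B - B * C) := by
      simp only [mul_assoc, hCA', mul_add, mul_smul_comm]
    rw [← h1, h2, zero_mul, mul_zero, sub_zero, mul_zero, zero_mul, add_zero] at h3
    exact hdiv 2 _ (by norm_num) h3.symm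
  -- A last commutator with `B` isolates `C⁴`; multiplying by `C³` kills the remainder through `A C³
  -- = 0`.
  have h5 : A * (C * (C * C)) * B - B * (A * (C * (C * C))) =
      C ^ 4 + A * (C * (C * C) * B - B * (C * (C * C))) := by
    simp only [mul_assoc, hC', mul_sub, pow_succ, pow_zero, one_mul]
    abel
  have h6 : C * C * C * (C ^ 4 + A * (C * (C * C) * B - B * (C * (C * C)))) =
      C ^ 7 + A * (C * (C * C)) * (C * (C * C) * B - B * (C * (C * C))) := by
    simp only [mul_assoc, hCA', mul_add, pow_succ, pow_zero, one_mul]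
  rw [← h5, h4] at h6
  simpa using h6.symm

/-- If `A ^ 3 = 0` and `A` commutes with `[A, B]`, then `A B` is nilpotent. -/
theorem isNilpotent_mul_of_commute_commutator {A B C : Module.End k E} (hA : A ^ 3 = 0)
    (hC : A * B = B * A + C) (hAC : A * C = C * A) : IsNilpotent (A * B) := by
  let _ : Module ℚ (Module.End k E) := Module.compHom _ (algebraMap ℚ k)
  have hC7 := commutator_pow_eq_zero hA hC hAC
  have hpow : ∀ p : ℕ, A * B * A ^ p = A ^ p * (A * B - p • C) := by
    intro p
    induction p with
    | zero => simp
    | succ p ih =>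
      calc A * B * A ^ (p + 1) = (A * B * A ^ p) * A := by rw [pow_succ, ← mul_assoc]
        _ = A ^ p * (A * (B * A) - p • (C * A)) := by rw [ih]; noncomm_ring
        _ = A ^ p * (A * (A * B - C) - p • (A * C)) := by rw [hC, hAC]; noncomm_ring
        _ = _ := by rw [pow_succ, succ_nsmul]; noncomm_ring
  -- Modulo multiples of `A^(p+1)`, `A B` acts on `A^p` as `-pC`. As `C⁷ = 0`, each factor `(A B)⁷`
  -- raises the power of `A` by one, and three of them reach `A³ = 0`.
  have hstep : ∀ p n : ℕ, ∃ Y, (A * B) ^ n * A ^ p = A ^ p * (-(p • C)) ^ n + A ^ (p + 1) * Y := by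
    intro p n
    induction n with
    | zero => exact ⟨0, by simp⟩
    | succ n ih =>
      obtain ⟨Y, hY⟩ := ih
      refine ⟨B * (-(p • C)) ^ n + (A * B - (p + 1) • C) * Y, ?_⟩
      rw [pow_succ' (A * B), mul_assoc, hY, mul_add, ← mul_assoc, ← mul_assoc, hpow, hpow,
        pow_succ' (-(p • C)), pow_succ A p]
      noncomm_ring
  have h7 : ∀ p : ℕ, ∃ Y, (A * B) ^ 7 * A ^ p = A ^ (p + 1) * Y := by
    intro p
    obtain ⟨Y, hY⟩ := hstep p 7
    refine ⟨Y, ?_⟩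
    rw [hY, neg_pow, ← Nat.cast_smul_eq_nsmul k, smul_pow, hC7]
    simp
  obtain ⟨Y0, h0⟩ := h7 0
  obtain ⟨Y1, h1⟩ := h7 1
  obtain ⟨Y2, h2⟩ := h7 2
  refine ⟨7 + (7 + 7), ?_⟩
  rw [pow_zero, mul_one, zero_add] at h0
  calc (A * B) ^ (7 + (7 + 7)) = (A * B) ^ 7 * ((A * B) ^ 7 * (A * B) ^ 7) := by simp only [pow_add]
    _ = (A * B) ^ 7 * (((A * B) ^ 7 * A ^ 1) * Y0) := by rw [mul_assoc _ (A ^ 1), ← h0]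
    _ = ((A * B) ^ 7 * A ^ 2) * (Y1 * Y0) := by rw [h1]; noncomm_ring
    _ = 0 := by rw [h2, hA, zero_mul, zero_mul]

end NilpotentProduct

/-! ### Three-step gradings defined by the eigenvalues of `ad h`. -/

section GradingElement

variable (k : Type*) {M : Type*} [Field k] [LieRing M] [LieAlgebra k M]

/-- The elements of degree `i` for the grading defined by the eigenvalues of `ad h`. -/
def gradePiece (h : M) (i : ℤ) : Submodule k M := (LieAlgebra.ad k M h).eigenspace (i : k)

variable {k}

theorem mem_gradePiece {h : M} {i : ℤ} {x : M} : x ∈ gradePiece k h i ↔ ⁅h, x⁆ = (i : k) • x := by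
  rw [gradePiece, Module.End.mem_eigenspace_iff, LieAlgebra.ad_apply]

theorem lie_mem_gradePiece {h : M} {i j : ℤ} {x y : M} (hx : x ∈ gradePiece k h i)
    (hy : y ∈ gradePiece k h j) : ⁅x, y⁆ ∈ gradePiece k h (i + j) := by
  rw [mem_gradePiece] at *
  rw [leibniz_lie, hx, hy, smul_lie, lie_smul, ← add_smul]
  push_cast
  rfl

/-- The eigenvalues of `ad h` are among `-1, 0, 1`. -/
def IsGradingElement (h : M) : Prop := ∀ x : M, ⁅h, ⁅h, ⁅h, x⁆⁆⁆ = ⁅h, x⁆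

variable [CharZero k] {h : M}

theorem IsGradingElement.eq_zero (hh : IsGradingElement h) {i : ℤ} (hi : 1 < |i|) {x : M}
    (hx : x ∈ gradePiece k h i) : x = 0 := by
  have h3 := hh x
  rw [mem_gradePiece] at hx
  simp only [hx, lie_smul, smul_smul] at h3
  rw [← sub_eq_zero, ← sub_smul] at h3
  refine (smul_eq_zero.mp h3).resolve_left ?_
  norm_cast
  intro h0
  have h1 : i * ((i - 1) * (i + 1)) = 0 := by linear_combination h0
  rcases mul_eq_zero.mp h1 with h1 | h1
  · simp [h1] at hi
  rcases mul_eq_zero.mp h1 with h1 | h1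
  · rw [show i = 1 by omega] at hi; simp at hi
  · rw [show i = -1 by omega] at hi; simp at hi

/-- With `A = ad h` and `A³ = A`, the spectral projectors are `(A² - A)/2`, `1 - A²` and `(A² +
A)/2`. -/
theorem IsGradingElement.exists_decomposition (hh : IsGradingElement h) (x : M) :
    ∃ u ∈ gradePiece k h (-1), ∃ v ∈ gradePiece k h 0, ∃ w ∈ gradePiece k h 1, x = u + v + w := by
  refine ⟨(2 : k)⁻¹ • (⁅h, ⁅h, x⁆⁆ - ⁅h, x⁆), ?_, x - ⁅h, ⁅h, x⁆⁆, ?_,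
    (2 : k)⁻¹ • (⁅h, ⁅h, x⁆⁆ + ⁅h, x⁆), ?_, ?_⟩
  · rw [mem_gradePiece, lie_smul, lie_sub, hh]
    push_cast
    module
  · rw [mem_gradePiece, lie_sub, hh]
    simp
  · rw [mem_gradePiece, lie_smul, lie_add, hh]
    push_cast
    module
  · module

theorem IsGradingElement.lie_one_one (hh : IsGradingElement h) {x y : M}
    (hx : x ∈ gradePiece k h 1) (hy : y ∈ gradePiece k h 1) : ⁅x, y⁆ = 0 :=
  hh.eq_zero (by norm_num) (lie_mem_gradePiece hx hy)

theorem IsGradingElement.lie_neg_neg (hh : IsGradingElement h) {x y : M}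
    (hx : x ∈ gradePiece k h (-1)) (hy : y ∈ gradePiece k h (-1)) : ⁅x, y⁆ = 0 :=
  hh.eq_zero (by norm_num) (lie_mem_gradePiece hx hy)

theorem IsGradingElement.lie_lie_lie_one (hh : IsGradingElement h) {a b c : M}
    (ha : a ∈ gradePiece k h 1) (hb : b ∈ gradePiece k h 1) (hc : c ∈ gradePiece k h 1) (x : M) :
    ⁅a, ⁅b, ⁅c, x⁆⁆⁆ = 0 := by
  obtain ⟨u, hu, v, hv, w, hw, rfl⟩ := hh.exists_decomposition (k := k) x
  have h1 := hh.eq_zero (by norm_num)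
    (lie_mem_gradePiece ha (lie_mem_gradePiece hb (lie_mem_gradePiece hc hu)))
  have h2 := hh.eq_zero (by norm_num) (lie_mem_gradePiece hb (lie_mem_gradePiece hc hv))
  simp [lie_add, h1, h2, hh.lie_one_one hc hw]

theorem IsGradingElement.lie_lie_lie_neg (hh : IsGradingElement h) {a b c : M}
    (ha : a ∈ gradePiece k h (-1)) (hb : b ∈ gradePiece k h (-1)) (hc : c ∈ gradePiece k h (-1))
    (x : M) : ⁅a, ⁅b, ⁅c, x⁆⁆⁆ = 0 := by
  obtain ⟨u, hu, v, hv, w, hw, rfl⟩ := hh.exists_decomposition (k := k) x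
  have h1 := hh.eq_zero (by norm_num)
    (lie_mem_gradePiece ha (lie_mem_gradePiece hb (lie_mem_gradePiece hc hw)))
  have h2 := hh.eq_zero (by norm_num) (lie_mem_gradePiece hb (lie_mem_gradePiece hc hv))
  simp [lie_add, h1, h2, hh.lie_neg_neg hc hu]

theorem lie_comm_of_lie_eq_zero {a b : M} (hab : ⁅a, b⁆ = 0) (x : M) : ⁅a, ⁅b, x⁆⁆ = ⁅b, ⁅a, x⁆⁆ := by
  rw [leibniz_lie, hab, zero_lie, zero_add]

theorem IsGradingElement.conjExp_apply [Algebra ℚ k] (hh : IsGradingElement h) {c : M}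
    (hc : c ∈ gradePiece k h 1) (x : M) :
    conjExp k c x = x - ⁅c, x⁆ + (2 : k)⁻¹ • ⁅c, ⁅c, x⁆⁆ := by
  let _ : Module ℚ (M →ₗ[k] M) := Module.compHom _ (algebraMap ℚ k)
  have h3 : (-(LieAlgebra.ad k M c) : Module.End k M) ^ 3 = 0 := by
    ext y
    simp [pow_succ, hh.lie_lie_lie_one hc hc hc]
  have hsmul : ∀ (q : ℚ) (T : M →ₗ[k] M), q • T = (algebraMap ℚ k q) • T := fun _ _ => rfl
  have := IsNilpotent.exp_eq_sum h3
  rw [conjExp, this]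
  simp only [Finset.sum_range_succ, Finset.sum_range_zero, hsmul]
  simp [pow_succ, Nat.factorial, sub_eq_add_neg]

theorem IsGradingElement.conjExp_conjExp [Algebra ℚ k] (hh : IsGradingElement h) {a b : M}
    (ha : a ∈ gradePiece k h 1) (hb : b ∈ gradePiece k h 1) (x : M) :
    conjExp k a (conjExp k b x) = conjExp k (a + b) x := by
  have hz := fun {a b c : M} (ha : a ∈ gradePiece k h 1) hb hc =>
    hh.lie_lie_lie_one (k := k) (a := a) (b := b) (c := c) ha hb hc
  rw [hh.conjExp_apply ha, hh.conjExp_apply hb, hh.conjExp_apply (add_mem ha hb)]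
  simp only [lie_add, add_lie, lie_sub, lie_smul, hz ha hb hb, hz ha ha hb,
    lie_comm_of_lie_eq_zero (hh.lie_one_one hb ha), lie_zero]
  module

theorem IsGradingElement.conjExp_zero [Algebra ℚ k] (hh : IsGradingElement h) (x : M) :
    conjExp k (0 : M) x = x := by
  rw [hh.conjExp_apply (zero_mem _)]
  simp

/-- The product of the two truncated exponentials has surplus terms of orders three and four in `c`;
they vanish because `(ad c)³` and `(ad c)⁴` kill `[x, y]`. -/
theorem IsGradingElement.conjExp_lie [Algebra ℚ k] (hh : IsGradingElement h) {c : M}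
    (hc : c ∈ gradePiece k h 1) (x y : M) :
    conjExp k c ⁅x, y⁆ = ⁅conjExp k c x, conjExp k c y⁆ := by
  have hz := hh.lie_lie_lie_one (k := k) hc hc hc
  obtain ⟨x₁, hx₁⟩ : ∃ x₁, ⁅c, x⁆ = x₁ := ⟨_, rfl⟩
  obtain ⟨x₂, hx₂⟩ : ∃ x₂, ⁅c, x₁⁆ = x₂ := ⟨_, rfl⟩
  obtain ⟨y₁, hy₁⟩ : ∃ y₁, ⁅c, y⁆ = y₁ := ⟨_, rfl⟩
  obtain ⟨y₂, hy₂⟩ : ∃ y₂, ⁅c, y₁⁆ = y₂ := ⟨_, rfl⟩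
  have hx₃ : ⁅c, x₂⁆ = 0 := by rw [← hx₂, ← hx₁, hz]
  have hy₃ : ⁅c, y₂⁆ = 0 := by rw [← hy₂, ← hy₁, hz]
  have h3 := hz ⁅x, y⁆
  have h4 := congrArg (fun z => ⁅c, z⁆) h3
  simp only [leibniz_lie c, lie_add, hx₁, hx₂, hx₃, hy₁, hy₂, hy₃, lie_zero, zero_lie, zero_add,
    add_zero] at h3 h4
  have h3' : ⁅x₁, y₂⁆ = - ⁅x₂, y₁⁆ := by
    have : (3 : k) • (⁅x₁, y₂⁆ + ⁅x₂, y₁⁆) = 0 := by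
      rw [← h3]; module
    exact eq_neg_of_add_eq_zero_left ((smul_eq_zero.mp this).resolve_left (by norm_num))
  have h4' : ⁅x₂, y₂⁆ = 0 := by
    have : (6 : k) • ⁅x₂, y₂⁆ = 0 := by
      rw [← h4]; module
    exact (smul_eq_zero.mp this).resolve_left (by norm_num)
  rw [hh.conjExp_apply hc, hh.conjExp_apply hc, hh.conjExp_apply hc]
  simp only [leibniz_lie c, lie_add, add_lie, sub_lie, lie_sub, smul_lie, lie_smul, hx₁, hx₂, hy₁,
    hy₂, h3', h4']
  module

/-! ### Consequences of a nondegenerate Killing form. -/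

section Killing

/-- Computing `[y, [[y, z], [z, x]]]` in two ways gives opposite signs, so `(ad y ad z)² = 0` and
the trace vanishes. -/
theorem killing_apply_eq_zero_of_lie_lie {y : M} (z : M) (h2 : ∀ x : M, ⁅y, ⁅y, x⁆⁆ = 0) :
    killingForm k M y z = 0 := by
  have hnil : IsNilpotent (LieAlgebra.ad k M y * LieAlgebra.ad k M z) := by
    refine ⟨2, ?_⟩
    ext x
    have h1 : ⁅y, ⁅⁅y, z⁆, ⁅z, x⁆⁆⁆ = ⁅y, ⁅z, ⁅y, ⁅z, x⁆⁆⁆⁆ := by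
      rw [leibniz_lie, h2 z, zero_lie, zero_add, lie_lie, h2, lie_zero, sub_zero]
    have h3 : ⁅y, ⁅⁅y, z⁆, ⁅z, x⁆⁆⁆ = - ⁅y, ⁅z, ⁅y, ⁅z, x⁆⁆⁆⁆ := by
      rw [lie_lie, lie_sub, h2, zero_sub]
    have h4 : (2 : k) • ⁅y, ⁅z, ⁅y, ⁅z, x⁆⁆⁆⁆ = 0 := by
      rw [two_smul]
      nth_rewrite 1 [← h1]
      rw [h3, neg_add_cancel]
    simpa [pow_two] using h4
  rw [killingForm_apply_apply]
  exact (LinearMap.isNilpotent_trace_of_isNilpotent hnil).eq_zero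

/-- The hypothesis makes `ad f` commute with `[ad f, ad z]`, so `ad f ad z` is nilpotent and has
trace zero. -/
theorem IsGradingElement.killing_apply_eq_zero (hh : IsGradingElement h) {f z : M}
    (hf : f ∈ gradePiece k h (-1)) (hz : ⁅f, ⁅f, z⁆⁆ = 0) : killingForm k M f z = 0 := by
  have hnil : IsNilpotent (LieAlgebra.ad k M f * LieAlgebra.ad k M z) := by
    refine isNilpotent_mul_of_commute_commutator (C := LieAlgebra.ad k M ⁅f, z⁆) ?_ ?_ ?_
    · ext x
      simp [pow_succ, hh.lie_lie_lie_neg hf hf hf]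
    · ext x
      simp
    · ext x
      simp only [Module.End.mul_apply, LieAlgebra.ad_apply]
      exact lie_comm_of_lie_eq_zero hz x
  rw [killingForm_apply_apply]
  exact (LinearMap.isNilpotent_trace_of_isNilpotent hnil).eq_zero

variable (hK : (killingForm k M).Nondegenerate)

include hK

/-- `(ad y)²` kills degrees `0` and `1` for degree reasons, hence everything; `y` is then in the
Killing radical. -/
theorem IsGradingElement.eq_zero_of_lie_lie (hh : IsGradingElement h) {y : M}
    (hy : y ∈ gradePiece k h 1) (h2 : ∀ x ∈ gradePiece k h (-1), ⁅y, ⁅y, x⁆⁆ = 0) : y = 0 := by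
  refine hK.1 y fun z => killing_apply_eq_zero_of_lie_lie z fun x => ?_
  obtain ⟨u, hu, v, hv, w, hw, rfl⟩ := hh.exists_decomposition (k := k) x
  have h3 := hh.eq_zero (by norm_num) (lie_mem_gradePiece hy (lie_mem_gradePiece hy hv))
  simp [lie_add, h2 u hu, h3, hh.lie_one_one hy hw]

/-- `(ad f)²` is self-adjoint for the Killing form, so its range is the orthogonal of its kernel,
and `f` is orthogonal to that kernel. Only the degree `1` component of a preimage matters. -/
theorem IsGradingElement.exists_lie_lie_eq [FiniteDimensional k M] (hh : IsGradingElement h) {f : M}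
    (hf : f ∈ gradePiece k h (-1)) : ∃ e ∈ gradePiece k h 1, ⁅f, ⁅f, e⁆⁆ = f := by
  let T : M →ₗ[k] M := LieAlgebra.ad k M f * LieAlgebra.ad k M f
  have hmem : f ∈ LinearMap.range T := by
    have hr : (killingForm k M).IsRefl := (LieModule.traceForm_isSymm k M M).isRefl
    rw [← LinearMap.BilinForm.orthogonal_orthogonal hK hr (LinearMap.range T)]
    intro z hz
    have hz0 : ⁅f, ⁅f, z⁆⁆ = 0 := by
      refine hK.1 _ fun x => ?_
      have := hz (T x) ⟨x, rfl⟩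
      simp only [T, Module.End.mul_apply, LieAlgebra.ad_apply] at this
      rw [LieModule.traceForm_apply_lie_apply', LieModule.traceForm_apply_lie_apply', neg_neg] at this
      rw [LieModule.traceForm_comm]
      exact this
    have := hh.killing_apply_eq_zero hf hz0
    rw [LieModule.traceForm_comm] at this
    exact this
  obtain ⟨x, hx⟩ := hmem
  obtain ⟨u, hu, v, hv, w, hw, rfl⟩ := hh.exists_decomposition (k := k) x
  refine ⟨w, hw, ?_⟩
  have h3 := hh.eq_zero (by norm_num) (lie_mem_gradePiece hf (lie_mem_gradePiece hf hv))
  simpa [T, lie_add, h3, hh.lie_neg_neg hf hu] using hx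

end Killing

/-- The relation `[[e, f], e] = 2e` needs injectivity: the difference of its sides has degree `1`
and is killed by `ad f`. -/
theorem isSl2Triple_of_lie_lie {f e : M} (hf : f ∈ gradePiece k h (-1))
    (hf0 : f ≠ 0) (he : e ∈ gradePiece k h 1) (hfe : ⁅f, ⁅f, e⁆⁆ = (-2 : k) • f)
    (hinj : ∀ y ∈ gradePiece k h 1, ⁅f, y⁆ = 0 → y = 0) :
    IsSl2Triple ⁅e, f⁆ e f := by
  have hf' : ⁅⁅e, f⁆, f⁆ = (-2 : k) • f := by
    rw [← hfe, ← lie_skew ⁅e, f⁆ f, ← lie_skew f e, lie_neg]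
  have hef : ⁅e, f⁆ ∈ gradePiece k h 0 := by simpa using lie_mem_gradePiece he hf
  refine ⟨?_, rfl, ?_, ?_⟩
  · intro h0
    rw [h0, zero_lie] at hf'
    exact hf0 ((smul_eq_zero.mp hf'.symm).resolve_left (by norm_num))
  · rw [← Nat.cast_smul_eq_nsmul k, ← sub_eq_zero]
    refine hinj _ (sub_mem (by simpa using lie_mem_gradePiece hef he) (Submodule.smul_mem _ _ he)) ?_
    rw [lie_sub, leibniz_lie, ← lie_skew f ⁅e, f⁆, hf', lie_smul, ← lie_skew f e, lie_neg, lie_self]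
    simp only [neg_lie, smul_lie, ← lie_skew f e]
    push_cast
    module
  · rw [hf', ← Nat.cast_smul_eq_nsmul k]
    push_cast
    module

/-! ### The linear equation that fixes the conjugating element. -/

section Triple

variable {e f t : M}

/-- Here `c` has `t`-weight `0` and `[f, c]` is killed by `e`. Since `(ad f)³ = 0`, applying `ad e`
to `(ad f)³ c` gives `(ad f)² c = 0`; applying `ad e` again gives `[f, c] = 0`. -/
theorem eq_zero_of_lie_lie_triple (hh : IsGradingElement h) (hT : IsSl2Triple t e f)
    (hf : f ∈ gradePiece k h (-1)) (he : e ∈ gradePiece k h 1)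
    (hinj : ∀ y ∈ gradePiece k h 1, ⁅f, y⁆ = 0 → y = 0)
    {c : M} (hc : c ∈ gradePiece k h 1) (h0 : ⁅e, ⁅c, f⁆⁆ = 0) : c = 0 := by
  have hte := hT.lie_h_e_nsmul
  have htf := hT.lie_h_f_nsmul
  rw [← Nat.cast_smul_eq_nsmul k] at hte htf
  have h0' : ⁅e, ⁅f, c⁆⁆ = 0 := by rw [← lie_skew f c, lie_neg, h0, neg_zero]
  have htc : ⁅t, c⁆ = 0 := by
    rw [← hT.lie_e_f, lie_lie, hh.lie_one_one he hc, lie_zero, sub_zero, h0']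
  have hv : ⁅t, ⁅f, c⁆⁆ = (-2 : k) • ⁅f, c⁆ := by
    rw [leibniz_lie, htf, htc, lie_zero, add_zero, neg_lie, smul_lie]
    push_cast
    module
  have hu : ⁅t, ⁅f, ⁅f, c⁆⁆⁆ = (-4 : k) • ⁅f, ⁅f, c⁆⁆ := by
    rw [leibniz_lie, htf, hv, lie_smul, neg_lie, smul_lie]
    push_cast
    module
  have heu : ⁅e, ⁅f, ⁅f, c⁆⁆⁆ = (-2 : k) • ⁅f, c⁆ := by
    rw [leibniz_lie, hT.lie_e_f, hv, h0', lie_zero, add_zero]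
  have h6 : ⁅e, ⁅f, ⁅f, ⁅f, c⁆⁆⁆⁆ = (-6 : k) • ⁅f, ⁅f, c⁆⁆ := by
    rw [leibniz_lie, hT.lie_e_f, hu, heu, lie_smul]
    module
  rw [hh.lie_lie_lie_neg hf hf hf, lie_zero] at h6
  have hu0 := (smul_eq_zero.mp h6.symm).resolve_left (by norm_num)
  rw [hu0, lie_zero] at heu
  exact hinj c hc ((smul_eq_zero.mp heu.symm).resolve_left (by norm_num))

theorem exists_lie_lie_triple [FiniteDimensional k M] (hh : IsGradingElement h)
    (hT : IsSl2Triple t e f)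
    (hf : f ∈ gradePiece k h (-1)) (he : e ∈ gradePiece k h 1)
    (hinj : ∀ y ∈ gradePiece k h 1, ⁅f, y⁆ = 0 → y = 0)
    {w : M} (hw : w ∈ gradePiece k h 1) : ∃ c ∈ gradePiece k h 1, ⁅e, ⁅c, f⁆⁆ = w := by
  let T : M →ₗ[k] M := - (LieAlgebra.ad k M e * LieAlgebra.ad k M f)
  have hTapp : ∀ c, T c = ⁅e, ⁅c, f⁆⁆ := by
    intro c
    rw [← lie_skew c f, lie_neg]
    rfl
  have hmaps : ∀ c ∈ gradePiece k h 1, T c ∈ gradePiece k h 1 := by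
    intro c hc
    rw [hTapp]
    simpa using lie_mem_gradePiece he (lie_mem_gradePiece hc hf)
  have hI : Function.Injective (T.restrict hmaps) := by
    rw [← LinearMap.ker_eq_bot, LinearMap.ker_eq_bot']
    intro c hc0
    apply Subtype.ext
    refine eq_zero_of_lie_lie_triple hh hT hf he hinj c.2 ?_
    rw [← hTapp]
    exact congrArg Subtype.val hc0
  obtain ⟨c, hc⟩ := LinearMap.injective_iff_surjective.mp hI ⟨w, hw⟩
  exact ⟨c, c.2, by rw [← hTapp]; exact congrArg Subtype.val hc⟩

/-- Bracketing with `e` kills degree `1`, so only the degree `0` part `v - [c, f]` contributes, and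
it is affine in `c`. -/
theorem lie_conjExp_sub [Algebra ℚ k] (hh : IsGradingElement h)
    (he : e ∈ gradePiece k h 1) {c v w : M} (hc : c ∈ gradePiece k h 1)
    (hv : v ∈ gradePiece k h 0) (hw : w ∈ gradePiece k h 1) :
    ⁅e, conjExp k c (f + v + w) - f⁆ = ⁅e, v⁆ - ⁅e, ⁅c, f⁆⁆ := by
  have h1 := hh.eq_zero (by norm_num) (lie_mem_gradePiece he (lie_mem_gradePiece hc hv))
  have h2 := hh.lie_lie_lie_one he hc hc
  rw [hh.conjExp_apply hc]
  simp only [lie_add, lie_sub, lie_smul, h1, h2, hh.lie_one_one he hw, hh.lie_one_one hc hw]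
  simp
  abel

end Triple

end GradingElement

/-! ### The grading is inner. -/

section GradingOfSimple

variable {g : Type*} [LieRing g] [LieAlgebra ℝ g]
  {ι : Type*} [Fintype ι] {t : Module.Basis ι ℝ g} {d : ι → ℤ}

theorem ThreeGrading.repr_eq_zero (𝒢 : ThreeGrading g) (ht : ∀ a, t a ∈ 𝒢.space (d a)) {i : ℤ}
    {y : g} (hy : y ∈ 𝒢.space i) {a : ι} (ha : d a ≠ i) : t.repr y a = 0 := by
  classical
  have hsplit : y = ∑ b with d b = i, t.repr y b • t b + ∑ b with ¬ d b = i, t.repr y b • t b := by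
    rw [Finset.sum_filter_add_sum_filter_not, t.sum_repr]
  have h1 : ∑ b with ¬ d b = i, t.repr y b • t b ∈ 𝒢.space i := by
    rw [eq_sub_of_add_eq' hsplit.symm]
    refine sub_mem hy (sum_mem fun b hb => ?_)
    have hb' : d b = i := by simpa using hb
    exact Submodule.smul_mem _ _ (hb' ▸ ht b)
  have h2 : ∑ b with ¬ d b = i, t.repr y b • t b ∈ ⨆ j ≠ i, 𝒢.space j := by
    refine sum_mem fun b hb => ?_
    have hb' : d b ≠ i := by simpa using hb
    exact Submodule.mem_iSup_of_mem (d b) (Submodule.mem_iSup_of_mem hb' (Submodule.smul_mem _ _ (ht b)))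
  have h0 : ∑ b with ¬ d b = i, t.repr y b • t b = 0 :=
    Submodule.disjoint_def.mp (𝒢.isInternal.submodule_iSupIndep i) _ h1 h2
  have h3 := congrArg (fun z => t.repr z a) h0
  simpa [Finsupp.single_apply, ha] using h3

omit [Fintype ι] in
theorem ThreeGrading.degree_cube (𝒢 : ThreeGrading g) (ht : ∀ a, t a ∈ 𝒢.space (d a)) (a : ι) :
    d a * (d a * d a) = d a := by
  have h1 : ¬ 1 < |d a| := fun h => t.ne_zero a (by simpa [𝒢.eq_bot _ h] using ht a)
  have h2 := abs_le.mp (not_lt.mp h1)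
  have h3 : d a = -1 ∨ d a = 0 ∨ d a = 1 := by omega
  rcases h3 with h | h | h <;> simp [h]

theorem ThreeGrading.exists_gradingElement [FiniteDimensional ℝ g] [LieAlgebra.IsKilling ℝ g]
    (𝒢 : ThreeGrading g) (ht : ∀ a, t a ∈ 𝒢.space (d a)) :
    ∃ h : g, ∀ a, ⁅h, t a⁆ = (d a : ℝ) • t a := by
  let D : g →ₗ[ℝ] g := t.constr ℝ fun a => (d a : ℝ) • t a
  have hDt : ∀ a, D (t a) = (d a : ℝ) • t a := fun a => t.constr_basis ℝ _ a
  have hD : ∀ i, ∀ y ∈ 𝒢.space i, D y = (i : ℝ) • y := by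
    intro i y hy
    conv_lhs => rw [← t.sum_repr y]
    conv_rhs => rw [← t.sum_repr y]
    rw [map_sum, Finset.smul_sum]
    refine Finset.sum_congr rfl fun a _ => ?_
    rw [map_smul, hDt]
    by_cases ha : d a = i
    · rw [ha, smul_comm]
    · simp [𝒢.repr_eq_zero ht hy ha]
  -- Multiplication by the degree is a derivation; the Leibniz rule is an identity of bilinear maps,
  -- checked on the homogeneous basis.
  let D' : LieDerivation ℝ g g :=
    { toLinearMap := D
      leibniz' := by
        have h2 : (LieModule.toEnd ℝ g g : g →ₗ[ℝ] g →ₗ[ℝ] g).compr₂ D =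
            (LieModule.toEnd ℝ g g : g →ₗ[ℝ] g →ₗ[ℝ] g).compl₂ D -
              ((LieModule.toEnd ℝ g g : g →ₗ[ℝ] g →ₗ[ℝ] g).compl₂ D).flip := by
          refine t.ext fun a => t.ext fun b => ?_
          have h3 := hD _ _ (𝒢.lie_mem _ _ _ (ht a) _ (ht b))
          simp only [LinearMap.compr₂_apply, LinearMap.sub_apply, LinearMap.compl₂_apply,
            LinearMap.flip_apply, LieHom.coe_toLinearMap, LieModule.toEnd_apply_apply, hDt, h3,
            lie_smul, ← lie_skew (t b) (t a)]
          push_cast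
          module
        intro x y
        simpa using LinearMap.congr_fun₂ h2 x y }
  obtain ⟨h, hh⟩ := LieDerivation.IsKilling.exists_eq_ad D'
  refine ⟨h, fun a => ?_⟩
  rw [← hDt, ← LieDerivation.ad_apply_apply ℝ, hh]
  rfl

end GradingOfSimple

/-! ### Extension of scalars: grading and Killing form. -/

section BaseChange

variable (k : Type*) [Field k] [Algebra ℝ k] {g : Type*} [LieRing g] [LieAlgebra ℝ g]
  {ι : Type*} [Fintype ι] {t : Module.Basis ι ℝ g} {d : ι → ℤ} {h : g}

theorem eq_sum_repr_tmul (t : Module.Basis ι ℝ g) (x : k ⊗[ℝ] g) :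
    x = ∑ a, (t.baseChange k).repr x a ⊗ₜ[ℝ] t a := by
  conv_lhs => rw [← (t.baseChange k).sum_repr x]
  simp [TensorProduct.smul_tmul']

theorem repr_lie_one_tmul (hh : ∀ a, ⁅h, t a⁆ = (d a : ℝ) • t a) (x : k ⊗[ℝ] g) (a : ι) :
    (t.baseChange k).repr ⁅(1 : k) ⊗ₜ[ℝ] h, x⁆ a = (d a : k) * (t.baseChange k).repr x a := by
  classical
  conv_lhs => rw [eq_sum_repr_tmul k t x]
  simp only [lie_sum, LieAlgebra.ExtendScalars.bracket_tmul, hh, one_mul, map_sum,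
    Finsupp.finsetSum_apply, Module.Basis.baseChange_repr_tmul, map_smul, Finsupp.smul_apply,
    Module.Basis.repr_self, Finsupp.single_apply]
  simp [Algebra.smul_def, apply_ite (algebraMap ℝ k), ite_mul]

omit [Fintype ι] in
theorem one_tmul_mem_gradePiece {i : ℤ} {x : g} (hx : x ∈ gradePiece ℝ h i) :
    (1 : k) ⊗ₜ[ℝ] x ∈ gradePiece k ((1 : k) ⊗ₜ[ℝ] h) i := by
  rw [mem_gradePiece] at hx ⊢
  rw [LieAlgebra.ExtendScalars.bracket_tmul, hx, TensorProduct.tmul_smul]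
  rw [TensorProduct.smul_tmul', TensorProduct.smul_tmul', Algebra.smul_def, map_intCast, smul_eq_mul,
    one_mul]

theorem mem_gradePiece_iff_repr [CharZero k] (hh : ∀ a, ⁅h, t a⁆ = (d a : ℝ) • t a) {i : ℤ} {x : k ⊗[ℝ] g} :
    x ∈ gradePiece k ((1 : k) ⊗ₜ[ℝ] h) i ↔ ∀ a, d a ≠ i → (t.baseChange k).repr x a = 0 := by
  rw [mem_gradePiece]
  constructor
  · intro hx a ha
    have h1 := congrArg (fun z => (t.baseChange k).repr z a) hx
    simp only [repr_lie_one_tmul k hh, map_smul, Finsupp.smul_apply, smul_eq_mul] at h1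
    rw [← sub_eq_zero, ← sub_mul] at h1
    refine (mul_eq_zero.mp h1).resolve_left ?_
    rw [sub_eq_zero]
    exact_mod_cast ha
  · intro hx
    refine (t.baseChange k).repr.injective (Finsupp.ext fun a => ?_)
    rw [repr_lie_one_tmul k hh]
    by_cases ha : d a = i
    · simp [ha]
    · simp [hx a ha]

theorem ThreeGrading.baseChange_space [CharZero k] (𝒢 : ThreeGrading g) (ht : ∀ a, t a ∈ 𝒢.space (d a))
    (hh : ∀ a, ⁅h, t a⁆ = (d a : ℝ) • t a) (i : ℤ) :
    (𝒢.space i).baseChange k = gradePiece k ((1 : k) ⊗ₜ[ℝ] h) i := by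
  apply le_antisymm
  · rw [Submodule.baseChange_eq_span, Submodule.span_le]
    rintro _ ⟨y, hy, rfl⟩
    rw [SetLike.mem_coe, mem_gradePiece_iff_repr k hh]
    intro a ha
    simp [𝒢.repr_eq_zero ht hy ha]
  · intro x hx
    rw [mem_gradePiece_iff_repr k hh] at hx
    rw [eq_sum_repr_tmul k t x]
    refine sum_mem fun a _ => ?_
    by_cases ha : d a = i
    · exact Submodule.tmul_mem_baseChange_of_mem _ (ha ▸ ht a)
    · simp [hx a ha]

theorem ThreeGrading.space_eq_gradePiece (𝒢 : ThreeGrading g) (ht : ∀ a, t a ∈ 𝒢.space (d a))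
    (hh : ∀ a, ⁅h, t a⁆ = (d a : ℝ) • t a) (i : ℤ) :
    𝒢.space i = gradePiece ℝ h i := by
  ext x
  rw [mem_gradePiece]
  constructor
  · intro hx
    conv_lhs => rw [← t.sum_repr x]
    conv_rhs => rw [← t.sum_repr x]
    rw [lie_sum, Finset.smul_sum]
    refine Finset.sum_congr rfl fun a _ => ?_
    rw [lie_smul, hh]
    by_cases ha : d a = i
    · rw [ha, smul_comm]
    · simp [𝒢.repr_eq_zero ht hx ha]
  · intro hx
    rw [← t.sum_repr x]
    refine sum_mem fun a _ => ?_
    by_cases ha : d a = i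
    · exact Submodule.smul_mem _ _ (ha ▸ ht a)
    · have h1 : (d a : ℝ) * t.repr x a = i * t.repr x a := by
        have h2 := congrArg (fun z => t.repr z a) hx
        conv_lhs at h2 => rw [← t.sum_repr x]
        classical
        simpa only [lie_sum, lie_smul, hh, map_sum, map_smul, Finsupp.finsetSum_apply,
          Finsupp.smul_apply, Module.Basis.repr_self, Finsupp.single_apply, smul_eq_mul, mul_ite,
          mul_one, mul_zero, Finset.sum_ite_eq', Finset.mem_univ, if_true, mul_comm, ite_mul, zero_mul] using h2
      rw [← sub_eq_zero, ← sub_mul] at h1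
      rw [(mul_eq_zero.mp h1).resolve_left (by rw [sub_eq_zero]; exact_mod_cast ha), zero_smul]
      exact zero_mem _

theorem isGradingElement_of_cube (hd : ∀ a, d a * (d a * d a) = d a)
    (hh : ∀ a, ⁅h, t a⁆ = (d a : ℝ) • t a) : IsGradingElement h := by
  intro x
  rw [← t.sum_repr x]
  simp only [lie_sum, lie_smul, hh, smul_smul]
  refine Finset.sum_congr rfl fun a _ => ?_
  congr 1
  rw [mul_assoc, mul_assoc]
  congr 1
  exact_mod_cast hd a

theorem isGradingElement_one_tmul (hd : ∀ a, d a * (d a * d a) = d a)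
    (hh : ∀ a, ⁅h, t a⁆ = (d a : ℝ) • t a) : IsGradingElement ((1 : k) ⊗ₜ[ℝ] h) := by
  intro x
  refine (t.baseChange k).repr.injective (Finsupp.ext fun a => ?_)
  simp only [repr_lie_one_tmul k hh]
  rw [← mul_assoc, ← mul_assoc, mul_assoc (d a : k)]
  congr 1
  rw [← Int.cast_mul, ← Int.cast_mul, hd a]

/-- Pairing with the Killing-dual basis reads off the coordinates of `x`. -/
theorem killingForm_baseChange_nondegenerate [FiniteDimensional ℝ g] [LieAlgebra.IsKilling ℝ g]
    (t : Module.Basis ι ℝ g) : (killingForm k (k ⊗[ℝ] g)).Nondegenerate := by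
  classical
  have hn := LieAlgebra.IsKilling.killingForm_nondegenerate ℝ g
  have hs : (killingForm ℝ g).IsSymm := ⟨LieModule.traceForm_comm ℝ g g⟩
  have hbc : LieModule.traceForm k (k ⊗[ℝ] g) (k ⊗[ℝ] g) =
      LinearMap.BilinForm.baseChange k (killingForm ℝ g) := LieModule.traceForm_baseChange ℝ g g k
  have h1 : ∀ x : k ⊗[ℝ] g, (∀ y, killingForm k (k ⊗[ℝ] g) x y = 0) → x = 0 := by
    intro x hx
    refine (t.baseChange k).repr.injective (Finsupp.ext fun a => ?_)
    have h2 := hx ((1 : k) ⊗ₜ[ℝ] (LinearMap.BilinForm.dualBasis (killingForm ℝ g) hn t a))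
    rw [killingForm, hbc] at h2
    conv_lhs at h2 => rw [eq_sum_repr_tmul k t x]
    simpa [LinearMap.BilinForm.baseChange_tmul, LinearMap.BilinForm.apply_dualBasis_right hn hs]
      using h2
  refine ⟨h1, fun x hx => h1 x fun y => ?_⟩
  rw [LieModule.traceForm_comm]
  exact hx y

end BaseChange

/-! ### Maps acting on coefficients. -/

section MapCoeff

variable {k : Type*} [Field k] [Algebra ℝ k] {g : Type*} [LieRing g] [LieAlgebra ℝ g]
  {ι : Type*} [Fintype ι] {t : Module.Basis ι ℝ g}

/-- Apply a linear endomorphism of the scalars to the coefficients of an element of `k ⊗ g`. -/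
def mapCoeff (φ : k →ₗ[ℝ] k) : k ⊗[ℝ] g →ₗ[ℝ] k ⊗[ℝ] g := φ.rTensor g

@[simp]
theorem mapCoeff_tmul (φ : k →ₗ[ℝ] k) (c : k) (x : g) :
    mapCoeff φ (c ⊗ₜ[ℝ] x) = φ c ⊗ₜ[ℝ] x := rfl

omit [Fintype ι] in
theorem repr_mapCoeff (φ : k →ₗ[ℝ] k) (x : k ⊗[ℝ] g) (a : ι) :
    (t.baseChange k).repr (mapCoeff φ x) a = φ ((t.baseChange k).repr x a) := by
  induction x with
  | zero => simp
  | tmul c y => simp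
  | add x y hx hy => simp [hx, hy]

omit [Fintype ι] in
theorem mapCoeff_eq_self (t : Module.Basis ι ℝ g) {φ : k →ₗ[ℝ] k} {x : k ⊗[ℝ] g}
    (hx : ∀ a, φ ((t.baseChange k).repr x a) = (t.baseChange k).repr x a) : mapCoeff φ x = x :=
  (t.baseChange k).repr.injective (Finsupp.ext fun a => by rw [repr_mapCoeff, hx])

omit [Fintype ι] in
theorem mapCoeff_eq_zero (t : Module.Basis ι ℝ g) {φ : k →ₗ[ℝ] k} {x : k ⊗[ℝ] g}
    (hx : ∀ a, φ ((t.baseChange k).repr x a) = 0) : mapCoeff φ x = 0 :=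
  (t.baseChange k).repr.injective (Finsupp.ext fun a => by rw [repr_mapCoeff, hx]; simp)

theorem mapCoeff_derivation_lie (D : Derivation ℝ k k) (x y : k ⊗[ℝ] g) :
    mapCoeff (D : k →ₗ[ℝ] k) ⁅x, y⁆ =
      ⁅mapCoeff (D : k →ₗ[ℝ] k) x, y⁆ + ⁅x, mapCoeff (D : k →ₗ[ℝ] k) y⁆ := by
  induction x with
  | zero => simp
  | add x x' hx hx' => rw [add_lie, map_add, hx, hx', map_add, add_lie, add_lie]; abel
  | tmul c u =>
    induction y with
    | zero => simp
    | add y y' hy hy' => rw [lie_add, map_add, hy, hy', map_add, lie_add, lie_add]; abel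
    | tmul c' v =>
      simp only [LieAlgebra.ExtendScalars.bracket_tmul, mapCoeff_tmul, ← TensorProduct.add_tmul]
      congr 1
      simp only [Derivation.coeFn_coe, Derivation.leibniz, smul_eq_mul]
      ring

theorem mapCoeff_derivation_smul (D : Derivation ℝ k k) (c : k) (x : k ⊗[ℝ] g) :
    mapCoeff (D : k →ₗ[ℝ] k) (c • x) = D c • x + c • mapCoeff (D : k →ₗ[ℝ] k) x := by
  induction x with
  | zero => simp
  | add x y hx hy => simp only [smul_add, map_add, hx, hy]; abel
  | tmul c' u =>
    simp only [TensorProduct.smul_tmul', mapCoeff_tmul, smul_eq_mul, ← TensorProduct.add_tmul]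
    congr 1
    simp only [Derivation.coeFn_coe, Derivation.leibniz, smul_eq_mul]
    ring

theorem mapCoeff_algHom_lie (σ : k →ₐ[ℝ] k) (x y : k ⊗[ℝ] g) :
    mapCoeff σ.toLinearMap ⁅x, y⁆ = ⁅mapCoeff σ.toLinearMap x, mapCoeff σ.toLinearMap y⁆ := by
  induction x with
  | zero => simp
  | add x x' hx hx' => rw [add_lie, map_add, hx, hx', map_add, add_lie]
  | tmul c u =>
    induction y with
    | zero => simp
    | add y y' hy hy' => rw [lie_add, map_add, hy, hy', map_add, lie_add]
    | tmul c' v => simp [LieAlgebra.ExtendScalars.bracket_tmul]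

theorem mapCoeff_algHom_smul (σ : k →ₐ[ℝ] k) (c : k) (x : k ⊗[ℝ] g) :
    mapCoeff σ.toLinearMap (c • x) = σ c • mapCoeff σ.toLinearMap x := by
  induction x with
  | zero => simp
  | add x y hx hy => simp only [smul_add, map_add, hx, hy]
  | tmul c' u => simp [TensorProduct.smul_tmul']

/-- Linearity over the coefficients of `x` suffices. This lets linear equations with coefficients in
a subfield descend along projections and coordinate functionals. -/
theorem mapCoeff_lie_of_coeffs (t : Module.Basis ι ℝ g) {φ : k →ₗ[ℝ] k} {x : k ⊗[ℝ] g}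
    (hx : ∀ a c, φ ((t.baseChange k).repr x a * c) = (t.baseChange k).repr x a * φ c)
    (y : k ⊗[ℝ] g) : mapCoeff φ ⁅x, y⁆ = ⁅x, mapCoeff φ y⁆ := by
  induction y with
  | zero => simp
  | add y y' hy hy' => rw [lie_add, map_add, hy, hy', map_add, lie_add]
  | tmul c v =>
    rw [eq_sum_repr_tmul k t x]
    simp [sum_lie, LieAlgebra.ExtendScalars.bracket_tmul, hx]

omit [Fintype ι] in
theorem mapCoeff_smul_of_coeffs (t : Module.Basis ι ℝ g) {φ : k →ₗ[ℝ] k} {x : k ⊗[ℝ] g}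
    (hx : ∀ a c, φ ((t.baseChange k).repr x a * c) = (t.baseChange k).repr x a * φ c)
    (c : k) : mapCoeff φ (c • x) = φ c • x := by
  refine (t.baseChange k).repr.injective (Finsupp.ext fun a => ?_)
  rw [repr_mapCoeff]
  simp only [map_smul, Finsupp.smul_apply, smul_eq_mul]
  rw [mul_comm, hx, mul_comm]

theorem mapCoeff_mem_gradePiece [CharZero k] {d : ι → ℤ} {h : g}
    (hh : ∀ a, ⁅h, t a⁆ = (d a : ℝ) • t a) (φ : k →ₗ[ℝ] k) {i : ℤ} {x : k ⊗[ℝ] g}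
    (hx : x ∈ gradePiece k ((1 : k) ⊗ₜ[ℝ] h) i) :
    mapCoeff φ x ∈ gradePiece k ((1 : k) ⊗ₜ[ℝ] h) i := by
  rw [mem_gradePiece_iff_repr k hh] at hx ⊢
  intro a ha
  rw [repr_mapCoeff, hx a ha, map_zero]

theorem mapCoeff_algHom_conjExp [CharZero k] [Algebra ℚ k] {h : k ⊗[ℝ] g} (hh : IsGradingElement h)
    (σ : k →ₐ[ℝ] k) {c : k ⊗[ℝ] g} (hc : c ∈ gradePiece k h 1)
    (hc' : mapCoeff σ.toLinearMap c ∈ gradePiece k h 1) (x : k ⊗[ℝ] g) :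
    mapCoeff σ.toLinearMap (conjExp k c x) =
      conjExp k (mapCoeff σ.toLinearMap c) (mapCoeff σ.toLinearMap x) := by
  rw [hh.conjExp_apply hc, hh.conjExp_apply hc']
  simp only [map_add, map_sub, mapCoeff_algHom_smul, mapCoeff_algHom_lie, map_inv₀, map_ofNat]

end MapCoeff

/-! ### Conjugation as a universal polynomial formula in coordinates. -/

section Coordinates

variable {ι : Type*} [Fintype ι] {g : Type*} [LieRing g] [LieAlgebra ℝ g]
  (t : Module.Basis ι ℝ g)

/-- The Lie bracket in coordinates, over an arbitrary algebra of scalars. -/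
def coordLie {A : Type*} [CommRing A] [Algebra ℝ A] (u v : ι → A) (a : ι) : A :=
  ∑ b, ∑ c, u b * v c * algebraMap ℝ A (t.repr ⁅t b, t c⁆ a)

/-- Conjugation by `exp u` in coordinates, for `u` of degree `1`. -/
def coordConj {A : Type*} [CommRing A] [Algebra ℝ A] (u v : ι → A) (a : ι) : A :=
  v a - coordLie t u v a + algebraMap ℝ A 2⁻¹ * coordLie t u (coordLie t u v) a

theorem map_coordLie {A B : Type*} [CommRing A] [Algebra ℝ A] [CommRing B] [Algebra ℝ B]
    (φ : A →ₐ[ℝ] B) (u v : ι → A) (a : ι) :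
    φ (coordLie t u v a) = coordLie t (fun b => φ (u b)) (fun b => φ (v b)) a := by
  simp [coordLie]

theorem map_coordConj {A B : Type*} [CommRing A] [Algebra ℝ A] [CommRing B] [Algebra ℝ B]
    (φ : A →ₐ[ℝ] B) (u v : ι → A) (a : ι) :
    φ (coordConj t u v a) = coordConj t (fun b => φ (u b)) (fun b => φ (v b)) a := by
  simp only [coordConj, map_add, map_sub, map_mul, map_coordLie, AlgHom.commutes]

theorem repr_lie_eq_coordLie (x y : g) (a : ι) :
    t.repr ⁅x, y⁆ a = coordLie t (fun b => t.repr x b) (fun b => t.repr y b) a := by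
  conv_lhs => rw [← t.sum_repr x, ← t.sum_repr y]
  simp only [coordLie, sum_lie, lie_sum, smul_lie, lie_smul, map_sum, map_smul,
    Finsupp.finsetSum_apply, Finsupp.smul_apply, smul_eq_mul, Algebra.algebraMap_self,
    RingHom.id_apply, Finset.mul_sum]
  rw [Finset.sum_comm]
  exact Finset.sum_congr rfl fun b _ => Finset.sum_congr rfl fun c _ => by ring

theorem repr_baseChange_lie_eq_coordLie (k : Type*) [Field k] [Algebra ℝ k] (x y : k ⊗[ℝ] g)
    (a : ι) : (t.baseChange k).repr ⁅x, y⁆ a =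
      coordLie t (fun b => (t.baseChange k).repr x b) (fun b => (t.baseChange k).repr y b) a := by
  conv_lhs => rw [eq_sum_repr_tmul k t x, eq_sum_repr_tmul k t y]
  simp only [coordLie, sum_lie, lie_sum, LieAlgebra.ExtendScalars.bracket_tmul, map_sum,
    Finsupp.finsetSum_apply, Module.Basis.baseChange_repr_tmul, Algebra.smul_def]
  rw [Finset.sum_comm]
  exact Finset.sum_congr rfl fun b _ => Finset.sum_congr rfl fun c _ => by ring

theorem repr_conjExp_eq_coordConj {h : g} (hh : IsGradingElement h) {c : g}
    (hc : c ∈ gradePiece ℝ h 1) (x : g) (a : ι) :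
    t.repr (conjExp ℝ c x) a = coordConj t (fun b => t.repr c b) (fun b => t.repr x b) a := by
  rw [hh.conjExp_apply hc]
  simp only [map_add, map_sub, map_smul, Finsupp.add_apply, Finsupp.sub_apply, Finsupp.smul_apply,
    repr_lie_eq_coordLie, coordConj, smul_eq_mul, Algebra.algebraMap_self, RingHom.id_apply]

theorem repr_baseChange_conjExp_eq_coordConj (k : Type*) [Field k] [CharZero k] [Algebra ℚ k] [Algebra ℝ k]
    {h : k ⊗[ℝ] g} (hh : IsGradingElement h) {c : k ⊗[ℝ] g} (hc : c ∈ gradePiece k h 1)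
    (x : k ⊗[ℝ] g) (a : ι) :
    (t.baseChange k).repr (conjExp k c x) a =
      coordConj t (fun b => (t.baseChange k).repr c b) (fun b => (t.baseChange k).repr x b) a := by
  rw [hh.conjExp_apply hc]
  simp only [map_add, map_sub, map_smul, Finsupp.add_apply, Finsupp.sub_apply, Finsupp.smul_apply,
    repr_baseChange_lie_eq_coordLie, coordConj, smul_eq_mul, map_inv₀, map_ofNat]

/-- An invariant polynomial is invariant under conjugation by `exp c`, with `c` of degree `1` over
an extension of `ℝ`. -/
theorem aeval_conjExp_of_isInvariant {𝒢 : ThreeGrading g} {d : ι → ℤ}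
    (ht : ∀ a, t a ∈ 𝒢.space (d a)) {h : g} (hh : ∀ a, ⁅h, t a⁆ = (d a : ℝ) • t a)
    {P : MvPolynomial ι ℝ} (hP : IsInvariant t 𝒢 P)
    (k : Type*) [Field k] [CharZero k] [Algebra ℚ k] [Algebra ℝ k] {c : k ⊗[ℝ] g}
    (hc : c ∈ gradePiece k ((1 : k) ⊗ₜ[ℝ] h) 1) (x : k ⊗[ℝ] g) :
    MvPolynomial.aeval (fun a => (t.baseChange k).repr (conjExp k c x) a) P =
      MvPolynomial.aeval (fun a => (t.baseChange k).repr x a) P := by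
  classical
  have hd := 𝒢.degree_cube ht
  let u : ι → MvPolynomial (ι ⊕ ι) ℝ :=
    fun b => if d b = 1 then MvPolynomial.X (Sum.inl b) else 0
  let v : ι → MvPolynomial (ι ⊕ ι) ℝ := fun b => MvPolynomial.X (Sum.inr b)
  -- With independent variables for the degree `1` element and for the point, invariance at all real
  -- values becomes a polynomial identity, which specializes to any extension field.
  have key : MvPolynomial.aeval (coordConj t u v) P = MvPolynomial.aeval v P := by
    refine MvPolynomial.funext fun z => ?_
    let y : g := ∑ b, (if d b = 1 then z (Sum.inl b) else 0) • t b
    let X : g := ∑ b, z (Sum.inr b) • t b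
    have hy : y ∈ 𝒢.space 1 := by
      refine sum_mem fun b _ => ?_
      split_ifs with hb
      · exact Submodule.smul_mem _ _ (hb ▸ ht b)
      · simp
    have hyr : ∀ b, t.repr y b = if d b = 1 then z (Sum.inl b) else 0 := fun b => by
      simp only [y, t.repr_sum_self]
    have hXr : ∀ b, t.repr X b = z (Sum.inr b) := fun b => by
      simp only [X, t.repr_sum_self]
    have h1 := hP y hy X
    rw [𝒢.space_eq_gradePiece ht hh] at hy
    simp only [repr_conjExp_eq_coordConj t (isGradingElement_of_cube hd hh) hy, hyr, hXr] at h1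
    have hcomp : ∀ w : ι → MvPolynomial (ι ⊕ ι) ℝ,
        MvPolynomial.eval z (MvPolynomial.aeval w P) =
          MvPolynomial.eval (fun a => MvPolynomial.aeval z (w a)) P := by
      intro w
      rw [← MvPolynomial.coe_aeval_eq_eval, ← MvPolynomial.coe_aeval_eq_eval]
      change (MvPolynomial.aeval z) ((MvPolynomial.aeval w) P) = _
      rw [MvPolynomial.comp_aeval_apply]
      rfl
    rw [hcomp, hcomp]
    simp only [map_coordConj, u, v, apply_ite (MvPolynomial.aeval z), MvPolynomial.aeval_X, map_zero]
    exact h1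
  let s : ι ⊕ ι → k := Sum.elim (fun b => (t.baseChange k).repr c b)
    (fun b => (t.baseChange k).repr x b)
  have h2 := congrArg (MvPolynomial.aeval s) key
  rw [MvPolynomial.comp_aeval_apply, MvPolynomial.comp_aeval_apply] at h2
  have hu : ∀ b, MvPolynomial.aeval s (u b) = (t.baseChange k).repr c b := by
    intro b
    by_cases hb : d b = 1
    · simp [u, hb, s]
    · rw [mem_gradePiece_iff_repr k hh] at hc
      simp [u, hb, hc b hb]
  simp only [map_coordConj, hu, v, MvPolynomial.aeval_X, s, Sum.elim_inr] at h2
  simpa only [repr_baseChange_conjExp_eq_coordConj t k (isGradingElement_one_tmul k hd hh) hc]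
    using h2

end Coordinates

/-! ### Algebras of rational functions. -/

section RationalFunctions

variable {ι : Type*}

@[simp] theorem ofPoly_add (P Q : MvPolynomial ι ℝ) : ofPoly (P + Q) = ofPoly P + ofPoly Q :=
  map_add _ _ _

@[simp] theorem ofPoly_sub (P Q : MvPolynomial ι ℝ) : ofPoly (P - Q) = ofPoly P - ofPoly Q :=
  map_sub _ _ _

@[simp] theorem ofPoly_mul (P Q : MvPolynomial ι ℝ) : ofPoly (P * Q) = ofPoly P * ofPoly Q :=
  map_mul _ _ _

@[simp] theorem ofPoly_pow (P : MvPolynomial ι ℝ) (n : ℕ) : ofPoly (P ^ n) = ofPoly P ^ n :=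
  map_pow _ _ _

@[simp] theorem ofPoly_one : ofPoly (1 : MvPolynomial ι ℝ) = 1 := map_one _

theorem ofPoly_C (r : ℝ) : ofPoly (MvPolynomial.C r : MvPolynomial ι ℝ) = algebraMap ℝ (RatFun ι) r :=
  (IsScalarTower.algebraMap_apply ℝ (MvPolynomial ι ℝ) (RatFun ι) r).symm

theorem ofPoly_injective : Function.Injective (ofPoly : MvPolynomial ι ℝ → RatFun ι) :=
  IsFractionRing.injective _ _

theorem ofPoly_ne_zero {P : MvPolynomial ι ℝ} (hP : P ≠ 0) : ofPoly P ≠ 0 :=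
  fun h => hP (ofPoly_injective (h.trans (map_zero _).symm))

theorem exists_eq_ofPoly_div (f : RatFun ι) :
    ∃ P Q : MvPolynomial ι ℝ, Q ≠ 0 ∧ f = ofPoly P / ofPoly Q := by
  obtain ⟨P, Q, hQ, hf⟩ := IsFractionRing.div_surjective (A := MvPolynomial ι ℝ) f
  exact ⟨P, Q, nonZeroDivisors.ne_zero hQ, hf.symm⟩

theorem ofPoly_eq_aeval (P : MvPolynomial ι ℝ) : ofPoly P = MvPolynomial.aeval coordJ P := by
  induction P using MvPolynomial.induction_on with
  | C r => rw [ofPoly_C, MvPolynomial.aeval_C]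
  | add p q hp hq => rw [ofPoly_add, hp, hq, map_add]
  | mul_X p a hp => rw [ofPoly_mul, hp, map_mul, MvPolynomial.aeval_X, coordJ]

theorem ofNegPoly_eq_ofPoly (d : ι → ℤ) (Q : MvPolynomial (Neg d) ℝ) :
    ofNegPoly d Q = ofPoly (MvPolynomial.rename Subtype.val Q) := by
  rw [ofPoly_eq_aeval, MvPolynomial.aeval_rename]
  rfl

theorem ofNegPoly_ne_zero {d : ι → ℤ} {Q : MvPolynomial (Neg d) ℝ} (hQ : Q ≠ 0) :
    ofNegPoly d Q ≠ 0 := by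
  rw [ofNegPoly_eq_ofPoly]
  refine ofPoly_ne_zero fun h => hQ ?_
  exact MvPolynomial.rename_injective _ Subtype.val_injective (h.trans (map_zero _).symm)

/-- The field of rational functions of the `J_α`. -/
def negField (d : ι → ℤ) : IntermediateField ℝ (RatFun ι) :=
  IntermediateField.adjoin ℝ (Set.range fun α : Neg d => (coordJ α.1 : RatFun ι))

theorem mem_negField {d : ι → ℤ} {f : RatFun ι} : f ∈ negField d ↔ f ∈ negRational d := by
  rw [negField, IntermediateField.mem_adjoin_range_iff]
  constructor
  · rintro ⟨P, Q, rfl⟩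
    by_cases hQ : Q = 0
    -- Division by zero is `0` by convention, so this element is represented by `0/1`.
    · exact ⟨0, 1, one_ne_zero, by simp [hQ, ofNegPoly]⟩
    · exact ⟨P, Q, hQ, rfl⟩
  · rintro ⟨P, Q, -, rfl⟩
    exact ⟨P, Q, rfl⟩

theorem coordJ_mem_negField {d : ι → ℤ} (α : Neg d) : coordJ α.1 ∈ negField d :=
  IntermediateField.subset_adjoin _ _ ⟨α, rfl⟩

theorem ofNegPoly_mem_negField {d : ι → ℤ} (Q : MvPolynomial (Neg d) ℝ) :
    ofNegPoly d Q ∈ negField d :=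
  mem_negField.mpr ⟨Q, 1, one_ne_zero, by simp [ofNegPoly]⟩

theorem aeval_mem_subalgebra {σ A : Type*} [CommRing A] [Algebra ℝ A] (B : Subalgebra ℝ A)
    {v : σ → A} (hv : ∀ s, v s ∈ B) (P : MvPolynomial σ ℝ) : MvPolynomial.aeval v P ∈ B := by
  induction P using MvPolynomial.induction_on with
  | C r => rw [MvPolynomial.aeval_C]; exact B.algebraMap_mem r
  | add p q hp hq => rw [map_add]; exact add_mem hp hq
  | mul_X p a hp => rw [map_mul, MvPolynomial.aeval_X]; exact mul_mem hp (hv a)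

variable {S : Type*}

/-- The functions `P(W_s, J_α)/Q(J_α)` form a subalgebra. -/
def wSubalgebra (d : ι → ℤ) (W : S → RatFun ι) : Subalgebra ℝ (RatFun ι) where
  carrier := wAlgebra d W
  add_mem' := by
    rintro _ _ ⟨P, Q, hQ, rfl⟩ ⟨P', Q', hQ', rfl⟩
    refine ⟨P * MvPolynomial.rename Sum.inr Q' + MvPolynomial.rename Sum.inr Q * P', Q * Q',
      mul_ne_zero hQ hQ', ?_⟩
    rw [div_add_div _ _ (ofNegPoly_ne_zero hQ) (ofNegPoly_ne_zero hQ')]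
    simp [ofNegPoly, MvPolynomial.aeval_rename, Function.comp_def]
  mul_mem' := by
    rintro _ _ ⟨P, Q, hQ, rfl⟩ ⟨P', Q', hQ', rfl⟩
    refine ⟨P * P', Q * Q', mul_ne_zero hQ hQ', ?_⟩
    rw [div_mul_div_comm]
    simp [ofNegPoly]
  algebraMap_mem' r := ⟨MvPolynomial.C r, 1, one_ne_zero, by simp [ofNegPoly]⟩

theorem mem_wSubalgebra {d : ι → ℤ} {W : S → RatFun ι} {f : RatFun ι} :
    f ∈ wSubalgebra d W ↔ f ∈ wAlgebra d W := Iff.rfl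

theorem mem_wAlgebra_of_mem_negField {d : ι → ℤ} (W : S → RatFun ι) {f : RatFun ι}
    (hf : f ∈ negField d) : f ∈ wAlgebra d W := by
  obtain ⟨P, Q, hQ, rfl⟩ := mem_negField.mp hf
  exact ⟨MvPolynomial.rename Sum.inr P, Q, hQ, by
    simp [ofNegPoly, MvPolynomial.aeval_rename, Function.comp_def]⟩

theorem apply_mem_wAlgebra (d : ι → ℤ) (W : S → RatFun ι) (s : S) : W s ∈ wAlgebra d W :=
  ⟨MvPolynomial.X (Sum.inl s), 1, one_ne_zero, by simp [ofNegPoly]⟩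

theorem wAlgebra_subset {d : ι → ℤ} {W : S → RatFun ι} (B : Subalgebra ℝ (RatFun ι))
    (hW : ∀ s, W s ∈ B) (hB : ∀ f ∈ negField d, f ∈ B) {f : RatFun ι} (hf : f ∈ wAlgebra d W) :
    f ∈ B := by
  obtain ⟨P, Q, hQ, rfl⟩ := hf
  rw [div_eq_mul_inv]
  refine mul_mem (aeval_mem_subalgebra B ?_ P) (hB _ (inv_mem (ofNegPoly_mem_negField Q)))
  rintro (s | α)
  · exact hW s
  · exact hB _ (coordJ_mem_negField α)

/-- Taking the coordinates themselves as generators lets `wSubalgebra` serve for both algebras. -/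
theorem polyOverNeg_eq_wAlgebra (d : ι → ℤ) :
    polyOverNeg d = wAlgebra d (coordJ : ι → RatFun ι) := by
  ext f
  constructor
  · rintro ⟨P, Q, hQ, rfl⟩
    refine ⟨MvPolynomial.rename Sum.inl P, Q, hQ, ?_⟩
    rw [ofPoly_eq_aeval, MvPolynomial.aeval_rename]
    rfl
  · rintro ⟨P, Q, hQ, rfl⟩
    refine ⟨MvPolynomial.aeval (Sum.elim MvPolynomial.X fun α : Neg d => MvPolynomial.X α.1) P, Q,
      hQ, ?_⟩
    congr 1
    rw [ofPoly_eq_aeval, MvPolynomial.comp_aeval_apply]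
    congr 2
    funext s
    rcases s with a | α <;> simp

theorem mem_polyOverNeg_iff {d : ι → ℤ} {f : RatFun ι} :
    f ∈ polyOverNeg d ↔ f ∈ wSubalgebra d (coordJ : ι → RatFun ι) := by
  rw [polyOverNeg_eq_wAlgebra, mem_wSubalgebra]

theorem ofPoly_mem_polyOverNeg (d : ι → ℤ) (P : MvPolynomial ι ℝ) : ofPoly P ∈ polyOverNeg d :=
  ⟨P, 1, one_ne_zero, by simp [ofNegPoly]⟩

end RationalFunctions

/-! ### Partial derivatives of rational functions. -/

section PartialDerivative

variable {ι : Type*}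

/-- Differentiating the cross relation `p m = n q` shows that the quotient rule does not depend on
the chosen fraction. -/
theorem partialJ_div (a : ι) {p q : MvPolynomial ι ℝ} (hq : q ≠ 0) :
    partialJ a (ofPoly p / ofPoly q) =
      ofPoly (MvPolynomial.pderiv a p * q - p * MvPolynomial.pderiv a q) / ofPoly (q ^ 2) := by
  set f := ofPoly p / ofPoly q with hf
  set n := IsFractionRing.num (MvPolynomial ι ℝ) f with hn
  set m : MvPolynomial ι ℝ := (IsFractionRing.den (MvPolynomial ι ℝ) f : MvPolynomial ι ℝ) with hm
  have hm0 : m ≠ 0 := nonZeroDivisors.ne_zero (IsFractionRing.den (MvPolynomial ι ℝ) f).2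
  have hfd : f = ofPoly n / ofPoly m := by
    have h1 := IsFractionRing.mk'_num_den' (MvPolynomial ι ℝ) f
    exact h1.symm
  have hcross : p * m = n * q := by
    apply ofPoly_injective
    rw [ofPoly_mul, ofPoly_mul]
    have h1 := hf.symm.trans hfd
    rwa [div_eq_div_iff (ofPoly_ne_zero hq) (ofPoly_ne_zero hm0)] at h1
  have hder := congrArg (MvPolynomial.pderiv a) hcross
  simp only [Derivation.leibniz, smul_eq_mul] at hder
  change ofPoly (MvPolynomial.pderiv a n * m - n * MvPolynomial.pderiv a m) / ofPoly (m ^ 2) = _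
  rw [div_eq_div_iff (ofPoly_ne_zero (pow_ne_zero 2 hm0)) (ofPoly_ne_zero (pow_ne_zero 2 hq)),
    ← ofPoly_mul, ← ofPoly_mul]
  congr 1
  linear_combination (-(m * q)) * hder + (MvPolynomial.pderiv a m * q + m * MvPolynomial.pderiv a q) * hcross

theorem partialJ_ofPoly (a : ι) (p : MvPolynomial ι ℝ) :
    partialJ a (ofPoly p) = ofPoly (MvPolynomial.pderiv a p) := by
  have h1 := partialJ_div a (p := p) (q := 1) one_ne_zero
  simpa using h1

/-- The partial derivative as a derivation of the field of rational functions. -/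
def partialDer (a : ι) : Derivation ℝ (RatFun ι) (RatFun ι) :=
  have hadd : ∀ f h : RatFun ι, partialJ a (f + h) = partialJ a f + partialJ a h := by
    intro f h
    obtain ⟨p, q, hq, rfl⟩ := exists_eq_ofPoly_div f
    obtain ⟨p', q', hq', rfl⟩ := exists_eq_ofPoly_div h
    have h1 := ofPoly_ne_zero hq
    have h2 := ofPoly_ne_zero hq'
    rw [div_add_div _ _ h1 h2, ← ofPoly_mul, ← ofPoly_mul, ← ofPoly_add, ← ofPoly_mul,
      partialJ_div a hq, partialJ_div a hq', partialJ_div a (mul_ne_zero hq hq')]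
    simp only [map_add, Derivation.leibniz, smul_eq_mul, ofPoly_add, ofPoly_sub, ofPoly_mul,
      ofPoly_pow]
    field_simp
    ring
  have hmul : ∀ f h : RatFun ι, partialJ a (f * h) = f * partialJ a h + h * partialJ a f := by
    intro f h
    obtain ⟨p, q, hq, rfl⟩ := exists_eq_ofPoly_div f
    obtain ⟨p', q', hq', rfl⟩ := exists_eq_ofPoly_div h
    have h1 := ofPoly_ne_zero hq
    have h2 := ofPoly_ne_zero hq'
    rw [div_mul_div_comm, ← ofPoly_mul, ← ofPoly_mul,
      partialJ_div a hq, partialJ_div a hq', partialJ_div a (mul_ne_zero hq hq')]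
    simp only [Derivation.leibniz, smul_eq_mul, ofPoly_add, ofPoly_sub, ofPoly_mul,
      ofPoly_pow]
    field_simp
    ring
  Derivation.mk'
    { toFun := partialJ a
      map_add' := hadd
      map_smul' := fun r f => by
        rw [Algebra.smul_def, hmul, ← ofPoly_C, partialJ_ofPoly, MvPolynomial.pderiv_C]
        simp [ofPoly, Algebra.smul_def, IsScalarTower.algebraMap_apply ℝ (MvPolynomial ι ℝ) (RatFun ι)] }
    hmul

@[simp]
theorem partialDer_apply (a : ι) (f : RatFun ι) : partialDer a f = partialJ a f := rfl

theorem partialJ_coordJ [DecidableEq ι] (a b : ι) :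
    partialJ a (coordJ b) = if a = b then (1 : RatFun ι) else 0 := by
  rw [coordJ, partialJ_ofPoly, MvPolynomial.pderiv_X, Pi.single_apply]
  simp only [eq_comm]
  split_ifs <;> simp [ofPoly]

theorem partialJ_mem_polyOverNeg {d : ι → ℤ} (a : ι) {f : RatFun ι} (hf : f ∈ polyOverNeg d) :
    partialJ a f ∈ polyOverNeg d := by
  obtain ⟨P, Q, hQ, rfl⟩ := hf
  have hQ' : MvPolynomial.rename Subtype.val Q ≠ 0 := fun h =>
    ofNegPoly_ne_zero hQ (by rw [ofNegPoly_eq_ofPoly, h]; exact map_zero _)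
  rw [ofNegPoly_eq_ofPoly, partialJ_div a hQ']
  refine ⟨MvPolynomial.pderiv a P * MvPolynomial.rename Subtype.val Q -
    P * MvPolynomial.pderiv a (MvPolynomial.rename Subtype.val Q), Q ^ 2, pow_ne_zero 2 hQ, ?_⟩
  rw [ofNegPoly_eq_ofPoly, map_pow]

theorem derivation_ext_coordJ {D D' : Derivation ℝ (RatFun ι) (RatFun ι)}
    (hD : ∀ a, D (coordJ a) = D' (coordJ a)) : D = D' := by
  have hpoly : ∀ p : MvPolynomial ι ℝ, D (ofPoly p) = D' (ofPoly p) := by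
    intro p
    induction p using MvPolynomial.induction_on with
    | C r => rw [ofPoly_C, Derivation.map_algebraMap, Derivation.map_algebraMap]
    | add p q hp hq => rw [ofPoly_add, map_add, map_add, hp, hq]
    | mul_X p a hp =>
      have h1 : (ofPoly (MvPolynomial.X a) : RatFun ι) = coordJ a := rfl
      rw [ofPoly_mul, Derivation.leibniz, Derivation.leibniz, hp, h1, hD]
  ext f
  obtain ⟨p, q, hq, rfl⟩ := exists_eq_ofPoly_div f
  rw [Derivation.leibniz_div, Derivation.leibniz_div, hpoly, hpoly]

/-- Both sides are derivations in `f` that agree on the coordinates, which generate the field. -/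
theorem derivation_eq_sum [Fintype ι] (D : Derivation ℝ (RatFun ι) (RatFun ι)) (f : RatFun ι) :
    D f = ∑ b, partialJ b f * D (coordJ b) := by
  classical
  have happ : ∀ h, (∑ b, D (coordJ b) • partialDer b) h = ∑ b, partialJ b h * D (coordJ b) := by
    intro h
    rw [← Derivation.coeFnAddMonoidHom_apply, map_sum, Finset.sum_apply]
    exact Finset.sum_congr rfl fun b _ => mul_comm _ _
  have h1 : D = ∑ b, D (coordJ b) • partialDer b := by
    refine derivation_ext_coordJ fun a => ?_
    rw [happ]
    simp [partialJ_coordJ]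
  conv_lhs => rw [h1]
  exact happ f

/-- The kernel of a derivation, as a subalgebra. -/
def kerSubalgebra (D : Derivation ℝ (RatFun ι) (RatFun ι)) : Subalgebra ℝ (RatFun ι) where
  carrier := {f | D f = 0}
  add_mem' := fun {f h} (hf : D f = 0) (hh : D h = 0) => by simp [hf, hh]
  mul_mem' := fun {f h} (hf : D f = 0) (hh : D h = 0) => by simp [hf, hh]
  algebraMap_mem' r := by simp

theorem derivation_eq_zero_of_mem_negField {d : ι → ℤ} {D : Derivation ℝ (RatFun ι) (RatFun ι)}
    (hD : ∀ α : Neg d, D (coordJ α.1) = 0) {f : RatFun ι} (hf : f ∈ negField d) : D f = 0 := by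
  have h1 : ∀ P : MvPolynomial (Neg d) ℝ, D (ofNegPoly d P) = 0 := fun P =>
    aeval_mem_subalgebra (kerSubalgebra D) hD P
  obtain ⟨P, Q, -, rfl⟩ := mem_negField.mp hf
  rw [Derivation.leibniz_div, h1, h1]
  simp

end PartialDerivative

/-! ### The Lie–Poisson bracket through linear functions. -/

section LiePoisson

variable {ι g : Type*} [Fintype ι] [DecidableEq ι] [LieRing g] [LieAlgebra ℝ g]
  {V : Type*} [AddCommGroup V] [Module ℝ V] [LieRingModule g V] [LieModule ℝ g V]
  (t : Module.Basis ι ℝ g)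

theorem traceForm_lowered (hV : (LieModule.traceForm ℝ g V).Nondegenerate) (a b : ι) :
    LieModule.traceForm ℝ g V (lowered V t a) (t b) = if a = b then 1 else 0 := by
  have hmet : LinearMap.BilinForm.toMatrix t (LieModule.traceForm ℝ g V) = metric V t := by
    ext i j
    rw [LinearMap.BilinForm.toMatrix_apply]
    rfl
  have hdet : (metric V t).det ≠ 0 :=
    hmet ▸ (LinearMap.BilinForm.nondegenerate_iff_det_ne_zero t).mp hV
  have h1 : ((metric V t)⁻¹ * metric V t) a b = if a = b then 1 else 0 := by
    rw [Matrix.nonsing_inv_mul _ (isUnit_iff_ne_zero.mpr hdet), Matrix.one_apply]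
  rw [← h1, Matrix.mul_apply, lowered]
  simp [metric]

variable (V)

/-- The linear function `X ↦ tr_V (u X)`, as a polynomial in the coordinates. -/
def linPoly : g →ₗ[ℝ] MvPolynomial ι ℝ :=
  ∑ c, (LinearMap.toSpanSingleton ℝ (MvPolynomial ι ℝ) (MvPolynomial.X c)).comp
    ((LieModule.traceForm ℝ g V).flip (t c))

/-- The linear function `X ↦ tr_V (u X)`, as a rational function. -/
def linJ (u : g) : RatFun ι := ofPoly (linPoly V t u)

variable {V}

omit [DecidableEq ι] in
theorem linPoly_apply (u : g) :
    linPoly V t u = ∑ c, LieModule.traceForm ℝ g V u (t c) • MvPolynomial.X c := by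
  simp [linPoly]

omit [DecidableEq ι] in
theorem linJ_apply (u : g) :
    linJ V t u = ∑ c, algebraMap ℝ (RatFun ι) (LieModule.traceForm ℝ g V u (t c)) * coordJ c := by
  rw [linJ, linPoly_apply, ofPoly, map_sum]
  refine Finset.sum_congr rfl fun c _ => ?_
  rw [MvPolynomial.smul_eq_C_mul, map_mul]
  rfl

variable (hV : (LieModule.traceForm ℝ g V).Nondegenerate)

include hV in
theorem linPoly_lowered (a : ι) : linPoly V t (lowered V t a) = MvPolynomial.X a := by
  simp [linPoly_apply, traceForm_lowered t hV]

include hV in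
theorem linJ_lowered (a : ι) : linJ V t (lowered V t a) = coordJ a := by
  rw [linJ, linPoly_lowered t hV, coordJ]

include hV in
theorem sum_traceForm_smul_lowered (u : g) :
    ∑ a, LieModule.traceForm ℝ g V u (t a) • lowered V t a = u := by
  rw [← sub_eq_zero]
  refine hV.1 _ fun y => ?_
  rw [← t.sum_repr y]
  simp only [map_sum, map_smul]
  refine Finset.sum_eq_zero fun b _ => ?_
  simp [traceForm_lowered t hV]

include hV in
theorem traceForm_lowered_eq_repr (a : ι) (x : g) :
    LieModule.traceForm ℝ g V (lowered V t a) x = t.repr x a := by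
  conv_lhs => rw [← t.sum_repr x]
  simp only [map_sum, map_smul, traceForm_lowered t hV, smul_eq_mul, mul_ite, mul_one, mul_zero,
    Finset.sum_ite_eq, Finset.mem_univ, if_true]

omit [DecidableEq ι] in
theorem partialJ_linJ (a : ι) (u : g) :
    partialJ a (linJ V t u) = algebraMap ℝ (RatFun ι) (LieModule.traceForm ℝ g V u (t a)) := by
  classical
  rw [linJ, partialJ_ofPoly, linPoly_apply, ← ofPoly_C]
  congr 1
  simp [MvPolynomial.pderiv_X, Pi.single_apply, MvPolynomial.smul_eq_C_mul]

theorem poisson_eq (f h : RatFun ι) :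
    poisson V t f h =
      ∑ a, ∑ b, partialJ a f * partialJ b h * linJ V t ⁅lowered V t a, lowered V t b⁆ := by
  simp only [linJ_apply]
  rfl

include hV in
theorem poisson_linJ (u v : g) : poisson V t (linJ V t u) (linJ V t v) = linJ V t ⁅u, v⁆ := by
  have hsmul : ∀ (r : ℝ) (w : g), linJ V t (r • w) = algebraMap ℝ (RatFun ι) r * linJ V t w := by
    intro r w
    rw [linJ, map_smul, MvPolynomial.smul_eq_C_mul, ofPoly_mul, ofPoly_C, linJ]
  have hsum : ∀ w : ι → g, linJ V t (∑ a, w a) = ∑ a, linJ V t (w a) := by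
    intro w
    rw [linJ, map_sum, ofPoly, map_sum]
    rfl
  rw [poisson_eq]
  conv_rhs => rw [← sum_traceForm_smul_lowered t hV u, ← sum_traceForm_smul_lowered t hV v]
  simp only [sum_lie, lie_sum, smul_lie, lie_smul, hsum, hsmul, partialJ_linJ,
    Finset.mul_sum]
  rw [Finset.sum_comm]
  refine Finset.sum_congr rfl fun a _ => Finset.sum_congr rfl fun b _ => ?_
  ring

theorem poisson_skew (f h : RatFun ι) : poisson V t f h = - poisson V t h f := by
  rw [poisson_eq, poisson_eq, Finset.sum_comm, ← Finset.sum_neg_distrib]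
  refine Finset.sum_congr rfl fun b _ => ?_
  rw [← Finset.sum_neg_distrib]
  refine Finset.sum_congr rfl fun a _ => ?_
  have h1 : linJ V t ⁅lowered V t a, lowered V t b⁆ = - linJ V t ⁅lowered V t b, lowered V t a⁆ := by
    rw [← lie_skew, linJ, map_neg, ofPoly, map_neg]
    rfl
  rw [h1]
  ring

/-- The Hamiltonian derivation `{f, ·}`. -/
def poissonDer (V : Type*) [AddCommGroup V] [Module ℝ V] [LieRingModule g V] [LieModule ℝ g V]
    (f : RatFun ι) : Derivation ℝ (RatFun ι) (RatFun ι) :=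
  ∑ a, ∑ b, (partialJ a f * linJ V t ⁅lowered V t a, lowered V t b⁆) • partialDer b

theorem poissonDer_apply (f h : RatFun ι) : poissonDer t V f h = poisson V t f h := by
  rw [poisson_eq, poissonDer, ← Derivation.coeFnAddMonoidHom_apply, map_sum, Finset.sum_apply]
  refine Finset.sum_congr rfl fun a _ => ?_
  rw [map_sum, Finset.sum_apply]
  refine Finset.sum_congr rfl fun b _ => ?_
  change _ * partialJ b h = _
  ring

theorem poisson_mem_polyOverNeg {d : ι → ℤ} {f h : RatFun ι} (hf : f ∈ polyOverNeg d)
    (hh : h ∈ polyOverNeg d) : poisson V t f h ∈ polyOverNeg d := by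
  rw [poisson_eq, mem_polyOverNeg_iff]
  refine sum_mem fun a _ => sum_mem fun b _ => mul_mem (mul_mem ?_ ?_) ?_
  · exact mem_polyOverNeg_iff.mp (partialJ_mem_polyOverNeg a hf)
  · exact mem_polyOverNeg_iff.mp (partialJ_mem_polyOverNeg b hh)
  · exact mem_polyOverNeg_iff.mp (ofPoly_mem_polyOverNeg d _)

/-! ### Conjugation by `G₊` as a Poisson automorphism. -/

section Conjugation

variable {h x : g} (hG : IsGradingElement h) (hx : x ∈ gradePiece ℝ h 1)

omit [Fintype ι] [DecidableEq ι] in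
include hG hx in
theorem traceForm_conjExp (u v : g) :
    LieModule.traceForm ℝ g V (conjExp ℝ (-x) u) v =
      LieModule.traceForm ℝ g V u (conjExp ℝ x v) := by
  rw [hG.conjExp_apply hx, hG.conjExp_apply (neg_mem hx)]
  simp only [map_add, map_sub, map_smul, LinearMap.add_apply, LinearMap.sub_apply,
    LinearMap.smul_apply, neg_lie, lie_neg, map_neg, LinearMap.neg_apply,
    LieModule.traceForm_apply_lie_apply' ℝ g V x, neg_neg]

/-- The substitution `J ↦ e^{-ad x} J` on polynomials. -/
def conjPoly (V : Type*) [AddCommGroup V] [Module ℝ V] [LieRingModule g V] [LieModule ℝ g V]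
    (x : g) : MvPolynomial ι ℝ →ₐ[ℝ] MvPolynomial ι ℝ :=
  MvPolynomial.aeval fun a => linPoly V t (conjExp ℝ (-x) (lowered V t a))

include hV in
theorem conjPoly_linPoly (x u : g) :
    conjPoly t V x (linPoly V t u) = linPoly V t (conjExp ℝ (-x) u) := by
  rw [linPoly_apply, map_sum]
  conv_rhs => rw [← sum_traceForm_smul_lowered t hV u]
  rw [map_sum, map_sum]
  simp [conjPoly]

include hV hG hx in
theorem conjPoly_conjPoly_neg (P : MvPolynomial ι ℝ) :
    conjPoly t V (-x) (conjPoly t V x P) = P := by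
  have h1 : (conjPoly t V (-x)).comp (conjPoly t V x) = AlgHom.id ℝ _ := by
    refine MvPolynomial.algHom_ext fun a => ?_
    rw [AlgHom.comp_apply, ← linPoly_lowered t hV, conjPoly_linPoly t hV, conjPoly_linPoly t hV,
      neg_neg, hG.conjExp_conjExp hx (neg_mem hx), add_neg_cancel, hG.conjExp_zero]
    rfl
  exact DFunLike.congr_fun h1 P

/-- The substitution `J ↦ e^{-ad x} J` on rational functions. -/
def conjFun : RatFun ι ≃ₐ[ℝ] RatFun ι :=
  IsFractionRing.algEquivOfAlgEquiv (K := RatFun ι) (L := RatFun ι)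
    (AlgEquiv.ofAlgHom (conjPoly t V x) (conjPoly t V (-x))
      (AlgHom.ext fun P => by
        simpa using conjPoly_conjPoly_neg t hV hG (neg_mem hx) P)
      (AlgHom.ext fun P => conjPoly_conjPoly_neg t hV hG hx P))

theorem conjFun_ofPoly (P : MvPolynomial ι ℝ) :
    conjFun t hV hG hx (ofPoly P) = ofPoly (conjPoly t V x P) :=
  IsFractionRing.algEquivOfAlgEquiv_algebraMap _ _

theorem conjFun_linJ (u : g) :
    conjFun t hV hG hx (linJ V t u) = linJ V t (conjExp ℝ (-x) u) := by
  rw [linJ, conjFun_ofPoly, conjPoly_linPoly t hV, linJ]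

/-- The chain rule reduces the claim to pairs of coordinates, where it says that the conjugation is
a Lie algebra automorphism. -/
theorem poisson_conjFun (f f' : RatFun ι) :
    poisson V t (conjFun t hV hG hx f) (conjFun t hV hG hx f') =
      conjFun t hV hG hx (poisson V t f f') := by
  set σ := conjFun t hV hG hx with hσ
  have hchain : ∀ (D : Derivation ℝ (RatFun ι) (RatFun ι)) (f : RatFun ι),
      D (σ f) = ∑ b, σ (partialJ b f) * D (σ (coordJ b)) := by
    intro D f
    -- `σ⁻¹ D σ` is again a derivation, so it expands in partial derivatives; this is the chain rule
    -- for `σ`.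
    let D' : Derivation ℝ (RatFun ι) (RatFun ι) :=
      Derivation.mk' (σ.symm.toLinearMap ∘ₗ (D : RatFun ι →ₗ[ℝ] RatFun ι) ∘ₗ
        σ.toLinearMap) fun f h => by simp
    have hD : ∀ f, D' f = σ.symm (D (σ f)) := fun f => rfl
    have h1 := congrArg σ (derivation_eq_sum D' f)
    simpa only [hD, map_sum, map_mul, AlgEquiv.apply_symm_apply] using h1
  have hright : ∀ F f', poisson V t F (σ f') =
      ∑ c, σ (partialJ c f') * poisson V t F (σ (coordJ c)) := by
    intro F f'
    simpa only [poissonDer_apply] using hchain (poissonDer t V F) f'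
  have hleft : ∀ f H, poisson V t (σ f) H =
      ∑ b, σ (partialJ b f) * poisson V t (σ (coordJ b)) H := by
    intro f H
    rw [poisson_skew, hright, ← Finset.sum_neg_distrib]
    refine Finset.sum_congr rfl fun b _ => ?_
    rw [poisson_skew t H, mul_neg, neg_neg]
  have hbase : ∀ b c : ι, poisson V t (σ (coordJ b)) (σ (coordJ c)) =
      σ (linJ V t ⁅lowered V t b, lowered V t c⁆) := by
    intro b c
    rw [← linJ_lowered t hV b, ← linJ_lowered t hV c, hσ, conjFun_linJ, conjFun_linJ,
      conjFun_linJ,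
      poisson_linJ t hV, hG.conjExp_lie (neg_mem hx)]
  conv_rhs => rw [poisson_eq]
  rw [hleft, map_sum]
  refine Finset.sum_congr rfl fun b _ => ?_
  rw [hright, map_sum, Finset.mul_sum]
  refine Finset.sum_congr rfl fun c _ => ?_
  rw [hbase, map_mul, map_mul, mul_assoc]

end Conjugation

/-! ### The action of `g₊₁` on polynomials and on the `J_α`. -/

section Action

variable {h x : g} (hG : IsGradingElement h) (hx : x ∈ gradePiece ℝ h 1)

include hV hG in
-- Invariance of the trace form moves the conjugation from the point to the polynomial, and
-- polynomials over `ℝ` are determined by their values.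
theorem isInvariant_iff {𝒢 : ThreeGrading g} (h1 : 𝒢.space 1 = gradePiece ℝ h 1)
    (P : MvPolynomial ι ℝ) :
    IsInvariant t 𝒢 P ↔ ∀ x ∈ gradePiece ℝ h 1, conjPoly t V x P = P := by
  have key : ∀ x ∈ gradePiece ℝ h 1, ∀ X : g,
      MvPolynomial.eval (fun a => t.repr (conjExp ℝ x X) a) P =
        MvPolynomial.eval (fun a => t.repr X a) (conjPoly t V x P) := by
    intro x hx X
    have hev : ∀ u : g, MvPolynomial.aeval (fun a => t.repr X a) (linPoly V t u) =
        LieModule.traceForm ℝ g V u X := by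
      intro u
      conv_rhs => rw [← t.sum_repr X]
      rw [linPoly_apply]
      simp only [map_sum, map_smul, MvPolynomial.aeval_X, smul_eq_mul]
      exact Finset.sum_congr rfl fun b _ => mul_comm _ _
    rw [← MvPolynomial.coe_aeval_eq_eval, ← MvPolynomial.coe_aeval_eq_eval]
    change MvPolynomial.aeval _ P = MvPolynomial.aeval _ (conjPoly t V x P)
    rw [conjPoly, MvPolynomial.comp_aeval_apply]
    simp only [hev, traceForm_conjExp hG hx, traceForm_lowered_eq_repr t hV]
  rw [IsInvariant, h1]
  constructor
  · intro hP x hx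
    refine MvPolynomial.funext fun z => ?_
    have h2 := key x hx (∑ b, z b • t b)
    rw [hP x hx] at h2
    simpa only [t.repr_sum_self] using h2.symm
  · intro hP x hx X
    rw [key x hx, hP x hx]

theorem conjFun_coordJ (a : ι) : conjFun t hV hG hx (coordJ a) =
    ∑ b, (t.repr (conjExp ℝ x (t b)) a) • (coordJ b : RatFun ι) := by
  rw [← linJ_lowered t hV a, conjFun_linJ, linJ_apply]
  simp only [traceForm_conjExp hG hx, traceForm_lowered_eq_repr t hV, Algebra.smul_def]

include hV in
-- An invariant form pairs degree `i` only with degree `-i`. In particular `J_α` is the linear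
-- function attached to an element of `g₊₁`.
theorem lowered_mem_gradePiece {d : ι → ℤ} (hh : ∀ a, ⁅h, t a⁆ = (d a : ℝ) • t a) (a : ι) :
    lowered V t a ∈ gradePiece ℝ h (-d a) := by
  rw [mem_gradePiece, ← sub_eq_zero]
  refine hV.1 _ fun y => ?_
  rw [← t.sum_repr y]
  simp only [map_sum, map_smul]
  refine Finset.sum_eq_zero fun b _ => ?_
  rw [map_sub, LinearMap.sub_apply, LieModule.traceForm_apply_lie_apply', hh]
  by_cases hab : a = b
  · simp [traceForm_lowered t hV, hab]
  · simp [traceForm_lowered t hV, hab]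

/-- Each `J_α` is attached to an element of `g₊₁`, which is fixed because `g₊₁` is Abelian. -/
theorem conjFun_of_mem_negField {d : ι → ℤ} (hh : ∀ a, ⁅h, t a⁆ = (d a : ℝ) • t a) {f : RatFun ι}
    (hf : f ∈ negField d) : conjFun t hV hG hx f = f := by
  have h1 : ∀ α : Neg d, conjFun t hV hG hx (coordJ α.1) = coordJ α.1 := by
    intro α
    have h2 := lowered_mem_gradePiece t hV hh α.1
    rw [α.2, neg_neg] at h2
    rw [← linJ_lowered t hV, conjFun_linJ, hG.conjExp_apply (neg_mem hx),
      hG.lie_one_one (neg_mem hx) h2]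
    simp
  have h3 : ∀ P : MvPolynomial (Neg d) ℝ, conjFun t hV hG hx (ofNegPoly d P) = ofNegPoly d P := by
    intro P
    change (conjFun t hV hG hx).toAlgHom (MvPolynomial.aeval _ P) = _
    rw [MvPolynomial.comp_aeval_apply]
    congr 2
    exact funext h1
  obtain ⟨P, Q, -, rfl⟩ := mem_negField.mp hf
  rw [map_div₀, h3, h3]

include hV in
theorem poissonDer_coordJ (a b : ι) : poissonDer t V (coordJ a) (coordJ b) =
    - ∑ c, (t.repr ⁅lowered V t a, t c⁆ b) • (coordJ c : RatFun ι) := by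
  rw [poissonDer_apply, ← linJ_lowered t hV a, ← linJ_lowered t hV b, poisson_linJ t hV,
    linJ_apply, ← Finset.sum_neg_distrib]
  refine Finset.sum_congr rfl fun c _ => ?_
  rw [LieModule.traceForm_apply_lie_apply', traceForm_lowered_eq_repr t hV, Algebra.smul_def,
    map_neg, neg_mul]

end Action

end LiePoisson

/-! ### The generic element: injectivity, triple, and descent to `K`. -/

section GenericElement

variable {k : Type*} [Field k] [Algebra ℝ k] {g : Type*} [LieRing g] [LieAlgebra ℝ g]
  {ι : Type*} [Fintype ι] (t : Module.Basis ι ℝ g) (d : ι → ℤ) (J : ι → k)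

/-- The part of degree `i` of the element of `k ⊗ g` with coordinates `J`. -/
def gradedPart (i : ℤ) : k ⊗[ℝ] g := ∑ a, (if d a = i then J a else 0) ⊗ₜ[ℝ] t a

/-- The element of `k ⊗ g` with coordinates `J`. -/
def elementOf : k ⊗[ℝ] g := ∑ a, J a ⊗ₜ[ℝ] t a

variable {t d J}

theorem repr_sum_tmul (u : ι → k) (a : ι) :
    (t.baseChange k).repr (∑ b, u b ⊗ₜ[ℝ] t b) a = u a := by
  classical
  simp [Finsupp.single_apply]

theorem repr_elementOf (a : ι) : (t.baseChange k).repr (elementOf t J) a = J a :=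
  repr_sum_tmul J a

theorem repr_gradedPart (i : ℤ) (a : ι) :
    (t.baseChange k).repr (gradedPart t d J i) a = if d a = i then J a else 0 :=
  repr_sum_tmul _ a

theorem sum_neg_eq_gradedPart :
    ∑ α : Neg d, J α.1 ⊗ₜ[ℝ] t α.1 = gradedPart t d J (-1) := by
  rw [gradedPart, ← Finset.sum_subtype (Finset.univ.filter fun a => d a = -1) (by simp)
    (fun a => J a ⊗ₜ[ℝ] t a), Finset.sum_filter]
  refine Finset.sum_congr rfl fun a _ => ?_
  split_ifs <;> simp

theorem elementOf_eq_add (hd : ∀ a, d a * (d a * d a) = d a) :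
    elementOf t J = gradedPart t d J (-1) + gradedPart t d J 0 + gradedPart t d J 1 := by
  refine (t.baseChange k).repr.injective (Finsupp.ext fun a => ?_)
  simp only [map_add, Finsupp.add_apply, repr_gradedPart, repr_elementOf]
  have h1 : d a * ((d a - 1) * (d a + 1)) = 0 := by linear_combination hd a
  have h3 : d a = -1 ∨ d a = 0 ∨ d a = 1 := by
    rcases mul_eq_zero.mp h1 with h1 | h1
    · omega
    · rcases mul_eq_zero.mp h1 with h1 | h1 <;> omega
  rcases h3 with h | h | h <;> simp [h]

section Grading

variable [CharZero k] {h : g} (hh : ∀ a, ⁅h, t a⁆ = (d a : ℝ) • t a)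

include hh

theorem gradedPart_mem (i : ℤ) : gradedPart t d J i ∈ gradePiece k ((1 : k) ⊗ₜ[ℝ] h) i := by
  rw [mem_gradePiece_iff_repr k hh]
  intro a ha
  rw [repr_gradedPart, if_neg ha]

/-- Write `f` for the degree `-1` part. Applying `D a` to `[f, y] = 0` gives `[y, t^a] = [f, D_a
y]`, and `ad y` kills the right side because `y` commutes with both `f` and `D_a y`. -/
theorem lie_gradedPart_injective [DecidableEq ι] [FiniteDimensional ℝ g] [LieAlgebra.IsKilling ℝ g]
    (hd : ∀ a, d a * (d a * d a) = d a) (D : ι → Derivation ℝ k k)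
    (hD : ∀ a b, D a (J b) = if a = b then 1 else 0) {y : k ⊗[ℝ] g}
    (hy : y ∈ gradePiece k ((1 : k) ⊗ₜ[ℝ] h) 1) (hfy : ⁅gradedPart t d J (-1), y⁆ = 0) : y = 0 := by
  have hG := isGradingElement_one_tmul k hd hh
  have hbasis : ∀ a, d a = -1 → ⁅y, ⁅y, (1 : k) ⊗ₜ[ℝ] t a⁆⁆ = 0 := by
    intro a ha
    have h1 : mapCoeff (D a : k →ₗ[ℝ] k) (gradedPart t d J (-1)) = (1 : k) ⊗ₜ[ℝ] t a := by
      refine (t.baseChange k).repr.injective (Finsupp.ext fun b => ?_)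
      rw [repr_mapCoeff, repr_gradedPart]
      by_cases hab : a = b
      · subst hab
        simp [ha, hD]
      · by_cases hb : d b = -1 <;> simp [hb, hD, hab]
    have h2 := mapCoeff_derivation_lie (D a) (gradedPart t d J (-1)) y
    rw [hfy, map_zero, h1] at h2
    have h3 : ⁅y, (1 : k) ⊗ₜ[ℝ] t a⁆ = ⁅gradedPart t d J (-1), mapCoeff (D a : k →ₗ[ℝ] k) y⁆ := by
      rw [← lie_skew, neg_eq_iff_add_eq_zero]
      exact h2.symm
    rw [h3, leibniz_lie, ← lie_skew y, hfy,
      hG.lie_one_one hy (mapCoeff_mem_gradePiece hh _ hy)]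
    simp
  refine hG.eq_zero_of_lie_lie (killingForm_baseChange_nondegenerate k t) hy fun x hx => ?_
  rw [mem_gradePiece_iff_repr k hh] at hx
  rw [← (t.baseChange k).sum_repr x, lie_sum, lie_sum]
  refine Finset.sum_eq_zero fun a _ => ?_
  by_cases ha : d a = -1
  · rw [Module.Basis.baseChange_apply, lie_smul, lie_smul, hbasis a ha, smul_zero]
  · simp [hx a ha]

end Grading

/-- A projection onto a subalgebra which is linear over a smaller field. -/
theorem exists_projection (K : IntermediateField ℝ k) (A : Subalgebra ℝ k) (hKA : ∀ c ∈ K, c ∈ A) :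
    ∃ π : k →ₗ[ℝ] k, (∀ c ∈ K, ∀ x, π (c * x) = c * π x) ∧ (∀ x, π x ∈ A) ∧ ∀ x ∈ A, π x = x := by
  let N : Submodule K k :=
    { carrier := A
      add_mem' := fun hx hy => add_mem hx hy
      zero_mem' := zero_mem A
      smul_mem' := fun c x hx => mul_mem (hKA c.1 c.2) hx }
  obtain ⟨p, hp⟩ := LinearMap.exists_leftInverse_of_injective N.subtype N.ker_subtype
  refine ⟨(N.subtype ∘ₗ p).restrictScalars ℝ, fun c hc x => ?_, fun x => (p x).2, fun x hx => ?_⟩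
  · exact (N.subtype ∘ₗ p).map_smul (⟨c, hc⟩ : K) x
  · exact congrArg Subtype.val (LinearMap.congr_fun hp ⟨x, hx⟩)

/-- The equation `[f, [f, e]] = f` is linear in `e` with coefficients in `K`, so projecting a
solution `K`-linearly onto `K` gives another solution. -/
theorem exists_triple [CharZero k] [FiniteDimensional ℝ g] [LieAlgebra.IsKilling ℝ g] {h : g}
    (hh : ∀ a, ⁅h, t a⁆ = (d a : ℝ) • t a)
    (hinj : ∀ y ∈ gradePiece k ((1 : k) ⊗ₜ[ℝ] h) 1, ⁅gradedPart t d J (-1), y⁆ = 0 → y = 0)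
    (hd : ∀ a, d a * (d a * d a) = d a) (hJ : ∃ a, d a = -1 ∧ J a ≠ 0)
    (K : IntermediateField ℝ k) (hK : ∀ a, d a = -1 → J a ∈ K) :
    ∃ t0 ∈ gradePiece k ((1 : k) ⊗ₜ[ℝ] h) 0, ∃ tp ∈ gradePiece k ((1 : k) ⊗ₜ[ℝ] h) 1,
      IsSl2Triple ((2 : k) • t0) tp (gradedPart t d J (-1)) ∧
      (∀ a, (t.baseChange k).repr t0 a ∈ K) ∧ ∀ a, (t.baseChange k).repr tp a ∈ K := by
  have hG := isGradingElement_one_tmul k hd hh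
  have hf : gradedPart t d J (-1) ∈ gradePiece k ((1 : k) ⊗ₜ[ℝ] h) (-1) := gradedPart_mem hh (-1)
  have hfK : ∀ a, (t.baseChange k).repr (gradedPart t d J (-1)) a ∈ K := by
    intro a
    rw [repr_gradedPart]
    split_ifs with ha
    · exact hK a ha
    · exact zero_mem K
  set f := gradedPart t d J (-1) with hfdef
  obtain ⟨e, he, hfe⟩ := hG.exists_lie_lie_eq (killingForm_baseChange_nondegenerate k t) hf
  obtain ⟨π, hπK, hπ, hπid⟩ := exists_projection K K.toSubalgebra fun _ hc => hc
  have hπf : ∀ y, mapCoeff π ⁅f, y⁆ = ⁅f, mapCoeff π y⁆ :=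
    mapCoeff_lie_of_coeffs t fun a c => hπK _ (hfK a) c
  have hπe : ⁅f, ⁅f, mapCoeff π e⁆⁆ = f := by
    rw [← hπf, ← hπf, hfe]
    exact mapCoeff_eq_self t fun a => hπid _ (hfK a)
  have hem := mapCoeff_mem_gradePiece hh π he
  have hf0 : f ≠ 0 := by
    obtain ⟨a, ha, hJa⟩ := hJ
    intro h0
    have h1 := repr_gradedPart (t := t) (d := d) (J := J) (-1) a
    rw [← hfdef, h0, if_pos ha] at h1
    exact hJa (by simpa using h1.symm)
  -- The factor `-2` turns `[f, [f, e]] = f` into the `sl(2)` normalization.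
  let tp := (-2 : k) • mapCoeff π e
  have htp : tp ∈ gradePiece k ((1 : k) ⊗ₜ[ℝ] h) 1 := Submodule.smul_mem _ _ hem
  have hT : IsSl2Triple ⁅tp, f⁆ tp f :=
    isSl2Triple_of_lie_lie hf hf0 htp (by simp only [tp, lie_smul, hπe]) hinj
  have htpK : ∀ a, (t.baseChange k).repr tp a ∈ K := by
    intro a
    simp only [tp, map_smul, Finsupp.smul_apply, smul_eq_mul, repr_mapCoeff]
    exact mul_mem (neg_mem (ofNat_mem K 2)) (hπ _)
  refine ⟨(2 : k)⁻¹ • ⁅tp, f⁆, ?_, tp, htp, ?_, fun a => ?_, htpK⟩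
  · exact Submodule.smul_mem _ _ (by simpa using lie_mem_gradePiece htp hf)
  · rwa [smul_smul, mul_inv_cancel₀ two_ne_zero, one_smul]
  · simp only [map_smul, Finsupp.smul_apply, smul_eq_mul]
    refine mul_mem (inv_mem (ofNat_mem K 2)) ?_
    rw [repr_baseChange_lie_eq_coordLie, coordLie]
    exact sum_mem fun b _ => sum_mem fun c _ =>
      mul_mem (mul_mem (htpK b) (hfK c)) (K.algebraMap_mem _)

/-- The kernel of `ad x` is spanned by vectors with coefficients in the field of definition
of `x`. -/
theorem exists_ker_basis [FiniteDimensional ℝ g] (K : IntermediateField ℝ k) {x : k ⊗[ℝ] g}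
    (hx : ∀ a, (t.baseChange k).repr x a ∈ K) :
    ∃ (n : ℕ) (ℓ : Fin n → k ⊗[ℝ] g), LinearIndependent k ℓ ∧
      Submodule.span k (Set.range ℓ) = LinearMap.ker (LieAlgebra.ad k (k ⊗[ℝ] g) x) ∧
      ∀ s a, (t.baseChange k).repr (ℓ s) a ∈ K := by
  classical
  let S : Set (k ⊗[ℝ] g) := {y | ⁅x, y⁆ = 0 ∧ ∀ a, (t.baseChange k).repr y a ∈ K}
  obtain ⟨ℓ, hℓS, hℓspan, hℓ⟩ := Submodule.exists_fun_fin_finrank_span_eq k S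
  refine ⟨_, ℓ, hℓ, ?_, fun s => (hℓS s).2⟩
  rw [hℓspan]
  apply le_antisymm
  · rw [Submodule.span_le]
    intro y hy
    simpa using hy.1
  · intro y hy
    have hy0 : ⁅x, y⁆ = 0 := by simpa using hy
    let b := Module.Basis.ofVectorSpace K k
    let φ (i) : k →ₗ[ℝ] k := ((Algebra.linearMap K k) ∘ₗ b.coord i).restrictScalars ℝ
    have hφK : ∀ i, ∀ c ∈ K, ∀ z, φ i (c * z) = c * φ i z := fun i c hc z =>
      ((Algebra.linearMap K k) ∘ₗ b.coord i).map_smul (⟨c, hc⟩ : K) z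
    have hφmem : ∀ i z, φ i z ∈ K := fun i z => (b.coord i z).2
    let T := Finset.univ.biUnion fun a => (b.repr ((t.baseChange k).repr y a)).support
    -- Expanding the coefficients over a `K`-basis of `k` splits `y` into vectors over `K`; each is
    -- in the kernel because the coordinate functionals are `K`-linear.
    have hsum : y = ∑ i ∈ T, b i • mapCoeff (φ i) y := by
      refine (t.baseChange k).repr.injective (Finsupp.ext fun a => ?_)
      simp only [map_sum, map_smul, Finsupp.finsetSum_apply, Finsupp.smul_apply, smul_eq_mul,
        repr_mapCoeff]
      conv_lhs => rw [← b.linearCombination_repr ((t.baseChange k).repr y a)]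
      rw [Finsupp.linearCombination_apply, Finsupp.sum_of_support_subset (s := T)]
      · refine Finset.sum_congr rfl fun i _ => ?_
        rw [Algebra.smul_def, mul_comm]
        rfl
      · exact Finset.subset_biUnion_of_mem
          (fun a => (b.repr ((t.baseChange k).repr y a)).support) (Finset.mem_univ a)
      · simp
    rw [hsum]
    refine sum_mem fun i _ => Submodule.smul_mem _ _ (Submodule.subset_span ⟨?_, fun a => ?_⟩)
    · rw [← mapCoeff_lie_of_coeffs t fun a c => hφK i _ (hx a) c, hy0, map_zero]
    · rw [repr_mapCoeff]
      exact hφmem i _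

end GenericElement

/-! ### Existence, uniqueness and symmetries of the highest weight form. -/

section HighestWeightForm

variable {k : Type*} [Field k] [CharZero k] [Algebra ℚ k] [Algebra ℝ k]
  {g : Type*} [LieRing g] [LieAlgebra ℝ g] {ι : Type*} [Fintype ι] {t : Module.Basis ι ℝ g}
  {d : ι → ℤ} {J : ι → k} {h : g} {S : Type*} [Fintype S]

/-- The hypotheses under which the generic element with coordinates `J` has a unique highest weight
form: an `sl(2)`-triple through its part of degree `-1`, and a basis of highest weight vectors, both
with coefficients in `K`. -/
structure HwSetting (t : Module.Basis ι ℝ g) (d : ι → ℤ) (J : ι → k) (h : g)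
    (K : IntermediateField ℝ k) (T e : k ⊗[ℝ] g) (ℓ : S → k ⊗[ℝ] g) : Prop where
  lie_basis : ∀ a, ⁅h, t a⁆ = (d a : ℝ) • t a
  cube : ∀ a, d a * (d a * d a) = d a
  injective : ∀ y ∈ gradePiece k ((1 : k) ⊗ₜ[ℝ] h) 1, ⁅gradedPart t d J (-1), y⁆ = 0 → y = 0
  coeff_mem : ∀ a, d a = -1 → J a ∈ K
  triple : IsSl2Triple T e (gradedPart t d J (-1))
  plus_mem : e ∈ gradePiece k ((1 : k) ⊗ₜ[ℝ] h) 1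
  plus_coeff : ∀ a, (t.baseChange k).repr e a ∈ K
  linearIndependent : LinearIndependent k ℓ
  span_eq : Submodule.span k (Set.range ℓ) = LinearMap.ker (LieAlgebra.ad k (k ⊗[ℝ] g) e)
  hw_coeff : ∀ s a, (t.baseChange k).repr (ℓ s) a ∈ K

namespace HwSetting

variable {K : IntermediateField ℝ k} {T e : k ⊗[ℝ] g} {ℓ : S → k ⊗[ℝ] g}

section

omit [Algebra ℚ k] [Fintype S] [CharZero k]

variable (H : HwSetting t d J h K T e ℓ)

include H

theorem isGradingElement : IsGradingElement ((1 : k) ⊗ₜ[ℝ] h) :=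
  isGradingElement_one_tmul k H.cube H.lie_basis

theorem minus_coeff (a : ι) : (t.baseChange k).repr (gradedPart t d J (-1)) a ∈ K := by
  rw [repr_gradedPart]
  split_ifs with ha
  · exact H.coeff_mem a ha
  · exact zero_mem K

theorem eq_of_lie_lie_eq [CharZero k] {c c' : k ⊗[ℝ] g} (hc : c ∈ gradePiece k ((1 : k) ⊗ₜ[ℝ] h) 1)
    (hc' : c' ∈ gradePiece k ((1 : k) ⊗ₜ[ℝ] h) 1)
    (heq : ⁅e, ⁅c, gradedPart t d J (-1)⁆⁆ = ⁅e, ⁅c', gradedPart t d J (-1)⁆⁆) : c = c' := by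
  rw [← sub_eq_zero]
  refine eq_zero_of_lie_lie_triple H.isGradingElement H.triple (gradedPart_mem H.lie_basis (-1))
    H.plus_mem H.injective (sub_mem hc hc') ?_
  rw [sub_lie, lie_sub, heq, sub_self]

end

variable (H : HwSetting t d J h K T e ℓ)

include H

omit [Fintype S] in
theorem lie_conjExp_elementOf {c : k ⊗[ℝ] g} (hc : c ∈ gradePiece k ((1 : k) ⊗ₜ[ℝ] h) 1) :
    ⁅e, conjExp k c (elementOf t J) - gradedPart t d J (-1)⁆ =
      ⁅e, gradedPart t d J 0⁆ - ⁅e, ⁅c, gradedPart t d J (-1)⁆⁆ := by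
  rw [elementOf_eq_add H.cube]
  exact lie_conjExp_sub H.isGradingElement H.plus_mem hc (gradedPart_mem H.lie_basis 0)
    (gradedPart_mem H.lie_basis 1)

theorem lie_lie_eq_of_form {c : k ⊗[ℝ] g} (hc : c ∈ gradePiece k ((1 : k) ⊗ₜ[ℝ] h) 1) {W : S → k}
    (hW : conjExp k c (elementOf t J) = gradedPart t d J (-1) + ∑ s, W s • ℓ s) :
    ⁅e, ⁅c, gradedPart t d J (-1)⁆⁆ = ⁅e, gradedPart t d J 0⁆ := by
  have h1 := H.lie_conjExp_elementOf hc
  have h2 : ∑ s, W s • ℓ s ∈ LinearMap.ker (LieAlgebra.ad k (k ⊗[ℝ] g) e) := by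
    rw [← H.span_eq]
    exact sum_mem fun s _ => Submodule.smul_mem _ _ (Submodule.subset_span ⟨s, rfl⟩)
  rw [LinearMap.mem_ker, LieAlgebra.ad_apply] at h2
  rw [hW, add_sub_cancel_left, h2] at h1
  exact (sub_eq_zero.mp h1.symm).symm

theorem form_unique {c c' : k ⊗[ℝ] g} (hc : c ∈ gradePiece k ((1 : k) ⊗ₜ[ℝ] h) 1)
    (hc' : c' ∈ gradePiece k ((1 : k) ⊗ₜ[ℝ] h) 1) {W W' : S → k}
    (hW : conjExp k c (elementOf t J) = gradedPart t d J (-1) + ∑ s, W s • ℓ s)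
    (hW' : conjExp k c' (elementOf t J) = gradedPart t d J (-1) + ∑ s, W' s • ℓ s) :
    c = c' ∧ W = W' := by
  have hcc : c = c' := H.eq_of_lie_lie_eq hc hc'
    ((H.lie_lie_eq_of_form hc hW).trans (H.lie_lie_eq_of_form hc' hW').symm)
  refine ⟨hcc, funext ?_⟩
  subst hcc
  rw [hW] at hW'
  have h1 : ∑ s, (W s - W' s) • ℓ s = 0 := by
    simp only [sub_smul, Finset.sum_sub_distrib]
    rw [add_left_cancel hW', sub_self]
  intro s
  exact sub_eq_zero.mp (Fintype.linearIndependent_iff.mp H.linearIndependent _ h1 s)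

theorem exists_form [FiniteDimensional ℝ g] :
    ∃ c ∈ gradePiece k ((1 : k) ⊗ₜ[ℝ] h) 1, ∃ W : S → k,
      conjExp k c (elementOf t J) = gradedPart t d J (-1) + ∑ s, W s • ℓ s := by
  obtain ⟨c, hc, hce⟩ := exists_lie_lie_triple H.isGradingElement H.triple
    (gradedPart_mem H.lie_basis (-1)) H.plus_mem H.injective
    (w := ⁅e, gradedPart t d J 0⁆)
    (by simpa using lie_mem_gradePiece H.plus_mem (gradedPart_mem H.lie_basis 0))
  have h1 := H.lie_conjExp_elementOf hc
  rw [hce, sub_self] at h1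
  have h2 : conjExp k c (elementOf t J) - gradedPart t d J (-1) ∈
      Submodule.span k (Set.range ℓ) := by
    rw [H.span_eq, LinearMap.mem_ker, LieAlgebra.ad_apply, h1]
  obtain ⟨W, hW⟩ := (Submodule.mem_span_range_iff_exists_fun k).mp h2
  exact ⟨c, hc, W, by rw [hW]; abel⟩

section Form

variable {c : k ⊗[ℝ] g} (hc : c ∈ gradePiece k ((1 : k) ⊗ₜ[ℝ] h) 1) {W : S → k}
  (hW : conjExp k c (elementOf t J) = gradedPart t d J (-1) + ∑ s, W s • ℓ s)

include hc hW

/-- The coefficients of the highest weight form lie in any algebra containing `K` and the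
coordinates. -/
theorem form_mem (A : Subalgebra ℝ k) (hKA : ∀ x ∈ K, x ∈ A) (hJA : ∀ a, J a ∈ A) (s : S) :
    W s ∈ A := by
  obtain ⟨π, hπK, hπ, hπid⟩ := exists_projection K A hKA
  have hπe : ∀ y, mapCoeff π ⁅e, y⁆ = ⁅e, mapCoeff π y⁆ :=
    mapCoeff_lie_of_coeffs t fun a z => hπK _ (H.plus_coeff a) z
  have hπf : ∀ y, mapCoeff π ⁅gradedPart t d J (-1), y⁆ =
      ⁅gradedPart t d J (-1), mapCoeff π y⁆ :=
    mapCoeff_lie_of_coeffs t fun a z => hπK _ (H.minus_coeff a) z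
  have hπ0 : mapCoeff π (gradedPart t d J 0) = gradedPart t d J 0 := by
    refine mapCoeff_eq_self t fun a => hπid _ ?_
    rw [repr_gradedPart]
    split_ifs
    · exact hJA a
    · exact zero_mem A
  have heq := H.lie_lie_eq_of_form hc hW
  -- The linear equation for `c` has coefficients in `K` and a right side fixed by `π`, so `π(c)`
  -- solves it as well.
  have hcπ : mapCoeff π c = c := by
    refine H.eq_of_lie_lie_eq (mapCoeff_mem_gradePiece H.lie_basis π hc) hc ?_
    rw [heq, ← hπ0, ← hπe, ← heq, hπe, ← lie_skew c, map_neg, hπf, ← lie_skew (mapCoeff π c)]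
  have hcA : ∀ a, (t.baseChange k).repr c a ∈ A := by
    intro a
    rw [← hcπ, repr_mapCoeff]
    exact hπ _
  have hlieA : ∀ u v : ι → k, (∀ a, u a ∈ A) → (∀ a, v a ∈ A) → ∀ a, coordLie t u v a ∈ A :=
    fun u v hu hv a => sum_mem fun b _ => sum_mem fun c _ =>
      mul_mem (mul_mem (hu b) (hv c)) (A.algebraMap_mem _)
  have hconjA : ∀ a, (t.baseChange k).repr (conjExp k c (elementOf t J)) a ∈ A := by
    intro a
    rw [repr_baseChange_conjExp_eq_coordConj t k H.isGradingElement hc]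
    simp only [repr_elementOf, coordConj]
    exact add_mem (sub_mem (hJA a) (hlieA _ _ hcA hJA a))
      (mul_mem (A.algebraMap_mem _) (hlieA _ _ hcA (hlieA _ _ hcA hJA) a))
  have hW' : conjExp k c (elementOf t J) = gradedPart t d J (-1) + ∑ s, π (W s) • ℓ s := by
    have h1 : mapCoeff π (conjExp k c (elementOf t J)) = conjExp k c (elementOf t J) :=
      mapCoeff_eq_self t fun a => hπid _ (hconjA a)
    rw [← h1, hW, map_add, map_sum]
    congr 1
    · exact mapCoeff_eq_self t fun a => hπid _ (hKA _ (H.minus_coeff a))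
    · exact Finset.sum_congr rfl fun s _ =>
        mapCoeff_smul_of_coeffs t (fun a z => hπK _ (H.hw_coeff s a) z) _
  rw [(H.form_unique hc hc hW hW').2]
  exact hπ _

/-- The coefficients of the highest weight form are invariant under conjugation by `exp x`. -/
theorem algHom_form {x : g} (hG : IsGradingElement h) (hx : x ∈ gradePiece ℝ h 1) (σ : k →ₐ[ℝ] k)
    (hσK : ∀ z ∈ K, σ z = z)
    (hσJ : ∀ a, σ (J a) = ∑ b, t.repr (conjExp ℝ x (t b)) a • J b) (s : S) : σ (W s) = W s := by
  have hx1 : (1 : k) ⊗ₜ[ℝ] x ∈ gradePiece k ((1 : k) ⊗ₜ[ℝ] h) 1 := one_tmul_mem_gradePiece k hx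
  have hconj : ∀ (z : k) (y : g),
      conjExp k ((1 : k) ⊗ₜ[ℝ] x) (z ⊗ₜ[ℝ] y) = z ⊗ₜ[ℝ] conjExp ℝ x y := by
    intro z y
    rw [H.isGradingElement.conjExp_apply hx1, hG.conjExp_apply hx]
    simp only [LieAlgebra.ExtendScalars.bracket_tmul, one_mul, TensorProduct.tmul_add,
      TensorProduct.tmul_sub, TensorProduct.tmul_smul]
    congr 1
    rw [TensorProduct.smul_tmul', TensorProduct.smul_tmul', smul_eq_mul, Algebra.smul_def, map_inv₀,
      map_ofNat]
  have hσtot : mapCoeff σ.toLinearMap (elementOf t J) =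
      conjExp k ((1 : k) ⊗ₜ[ℝ] x) (elementOf t J) := by
    simp only [elementOf, map_sum, mapCoeff_tmul, hconj, AlgHom.toLinearMap_apply, hσJ,
      TensorProduct.sum_tmul]
    rw [Finset.sum_comm]
    refine Finset.sum_congr rfl fun b _ => ?_
    conv_rhs => rw [← t.sum_repr (conjExp ℝ x (t b)), TensorProduct.tmul_sum]
    simp only [TensorProduct.tmul_smul, TensorProduct.smul_tmul']
  have hcσ := mapCoeff_mem_gradePiece H.lie_basis σ.toLinearMap hc
  -- Applying `σ` gives a form of `e^{-ad x} J_tot`; merging the two commuting exponentials gives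
  -- one of `J_tot` itself, with parameter `σ(c) + x`.
  have hW' : conjExp k (mapCoeff σ.toLinearMap c + (1 : k) ⊗ₜ[ℝ] x) (elementOf t J) =
      gradedPart t d J (-1) + ∑ s, σ (W s) • ℓ s := by
    rw [← H.isGradingElement.conjExp_conjExp hcσ hx1, ← hσtot,
      ← mapCoeff_algHom_conjExp H.isGradingElement σ hc hcσ, hW, map_add, map_sum]
    congr 1
    · exact mapCoeff_eq_self t fun a => hσK _ (H.minus_coeff a)
    · refine Finset.sum_congr rfl fun s _ => ?_
      rw [mapCoeff_algHom_smul]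
      congr 1
      exact mapCoeff_eq_self t fun a => hσK _ (H.hw_coeff s a)
  exact congrFun (H.form_unique (add_mem hcσ hx1) hc hW' hW).2 s

/-- The coefficients of the highest weight form are killed by the infinitesimal action of `g₊₁`. -/
theorem derivation_form {u : g} (hu : u ∈ gradePiece ℝ h 1) (D : Derivation ℝ k k)
    (hDK : ∀ z ∈ K, D z = 0)
    (hDJ : ∀ a, D (J a) = - ∑ b, t.repr ⁅u, t b⁆ a • J b) (s : S) : D (W s) = 0 := by
  have hG := H.isGradingElement
  have hu1 : (1 : k) ⊗ₜ[ℝ] u ∈ gradePiece k ((1 : k) ⊗ₜ[ℝ] h) 1 := one_tmul_mem_gradePiece k hu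
  set v := (1 : k) ⊗ₜ[ℝ] u with hv
  set δ : k ⊗[ℝ] g →ₗ[ℝ] k ⊗[ℝ] g := mapCoeff (D : k →ₗ[ℝ] k) with hδ
  have hδlie : ∀ x y : k ⊗[ℝ] g, δ ⁅x, y⁆ = ⁅δ x, y⁆ + ⁅x, δ y⁆ := mapCoeff_derivation_lie D
  have hδtot : δ (elementOf t J) = - ⁅v, elementOf t J⁆ := by
    simp only [hδ, hv, elementOf, map_sum, mapCoeff_tmul, lie_sum, one_mul,
      LieAlgebra.ExtendScalars.bracket_tmul, Derivation.coeFn_coe, hDJ, TensorProduct.neg_tmul,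
      TensorProduct.sum_tmul, Finset.sum_neg_distrib]
    rw [Finset.sum_comm]
    congr 1
    refine Finset.sum_congr rfl fun b _ => ?_
    conv_rhs => rw [← t.sum_repr ⁅u, t b⁆, TensorProduct.tmul_sum]
    simp only [TensorProduct.tmul_smul, TensorProduct.smul_tmul']
  have hδe : δ e = 0 := mapCoeff_eq_zero t fun a => hDK _ (H.plus_coeff a)
  have hδf : δ (gradedPart t d J (-1)) = 0 := mapCoeff_eq_zero t fun a => hDK _ (H.minus_coeff a)
  have hδc := mapCoeff_mem_gradePiece H.lie_basis (D : k →ₗ[ℝ] k) hc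
  have hδ0 : ⁅e, δ (gradedPart t d J 0)⁆ = - ⁅e, ⁅v, gradedPart t d J (-1)⁆⁆ := by
    have h1 := hδtot
    rw [elementOf_eq_add H.cube, map_add, map_add, hδf, zero_add] at h1
    have h2 := congrArg (fun z => ⁅e, z⁆) h1
    have h3 : ⁅e, δ (gradedPart t d J 1)⁆ = 0 := hG.lie_one_one H.plus_mem
      (mapCoeff_mem_gradePiece H.lie_basis _ (gradedPart_mem H.lie_basis 1))
    have h4 : ⁅v, gradedPart t d J 1⁆ = 0 := hG.lie_one_one hu1 (gradedPart_mem H.lie_basis 1)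
    have h5 : ⁅e, ⁅v, gradedPart t d J 0⁆⁆ = 0 := hG.eq_zero (by norm_num)
      (lie_mem_gradePiece H.plus_mem (lie_mem_gradePiece hu1 (gradedPart_mem H.lie_basis 0)))
    simpa only [lie_add, lie_neg, h3, h4, h5, lie_zero, add_zero] using h2
  -- Differentiate the linear equation for `c`; this is the infinitesimal counterpart of `c = σ(c) +
  -- x`.
  have hδceq : δ c = - v := by
    refine H.eq_of_lie_lie_eq hδc (neg_mem hu1) ?_
    have h1 := congrArg δ (H.lie_lie_eq_of_form hc hW)
    simp only [hδlie, hδe, hδf, zero_lie, lie_zero, zero_add, add_zero] at h1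
    rw [h1, hδ0, neg_lie, lie_neg]
  -- The variations of `c` and of `J_tot` cancel, since `ad v` and `ad c` commute.
  have hzero : δ (conjExp k c (elementOf t J)) = 0 := by
    have hsmul : ∀ y : k ⊗[ℝ] g, δ ((2 : k)⁻¹ • y) = (2 : k)⁻¹ • δ y := by
      intro y
      rw [hδ, mapCoeff_derivation_smul]
      have : D (2 : k)⁻¹ = 0 := hDK _ (inv_mem (ofNat_mem K 2))
      rw [this, zero_smul, zero_add]
    rw [hG.conjExp_apply hc]
    simp only [map_add, map_sub, hsmul, hδlie, hδceq, hδtot, neg_lie, lie_neg,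
      hG.lie_lie_lie_one hc hc hu1, lie_add, lie_comm_of_lie_eq_zero (hG.lie_one_one hu1 hc)]
    module
  have hsum : ∑ s, D (W s) • ℓ s = 0 := by
    rw [hW, map_add, hδf, zero_add, map_sum] at hzero
    rw [← hzero]
    refine Finset.sum_congr rfl fun s _ => ?_
    have : δ (ℓ s) = 0 := mapCoeff_eq_zero t fun a => hDK _ (H.hw_coeff s a)
    rw [hδ, mapCoeff_derivation_smul, ← hδ, this, smul_zero, add_zero]
  exact Fintype.linearIndependent_iff.mp H.linearIndependent _ hsum s

/-- The value of an invariant polynomial is determined by the highest weight form. -/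
theorem aeval_mem {𝒢 : ThreeGrading g} (ht : ∀ a, t a ∈ 𝒢.space (d a)) {P : MvPolynomial ι ℝ}
    (hP : IsInvariant t 𝒢 P) (B : Subalgebra ℝ k) (hKB : ∀ x ∈ K, x ∈ B) (hWB : ∀ s, W s ∈ B) :
    MvPolynomial.aeval J P ∈ B := by
  have h1 := aeval_conjExp_of_isInvariant t ht H.lie_basis hP k hc (elementOf t J)
  simp only [repr_elementOf] at h1
  change _ = MvPolynomial.aeval J P at h1
  rw [← h1, hW]
  refine aeval_mem_subalgebra B (fun a => ?_) P
  simp only [map_add, map_sum, map_smul, Finsupp.add_apply, Finsupp.finsetSum_apply,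
    Finsupp.smul_apply, smul_eq_mul]
  exact add_mem (hKB _ (H.minus_coeff a)) (sum_mem fun s _ => mul_mem (hWB s) (hKB _ (H.hw_coeff s a)))

end Form

end HwSetting

end HighestWeightForm

/-! ### Specialization to the coordinates `J_a`. -/

section RationalForm

variable {g : Type*} [LieRing g] [LieAlgebra ℝ g] {ι : Type*} [Fintype ι]
  {t : Module.Basis ι ℝ g} {d : ι → ℤ}

theorem tMinus_eq_gradedPart : tMinus t d = gradedPart (k := RatFun ι) t d coordJ (-1) :=
  sum_neg_eq_gradedPart (k := RatFun ι)

theorem lie_tMinus_injective [DecidableEq ι] [FiniteDimensional ℝ g] [LieAlgebra.IsKilling ℝ g]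
    {h : g} (hh : ∀ a, ⁅h, t a⁆ = (d a : ℝ) • t a) (hd : ∀ a, d a * (d a * d a) = d a) :
    ∀ y ∈ gradePiece (RatFun ι) ((1 : RatFun ι) ⊗ₜ[ℝ] h) 1,
      ⁅gradedPart (k := RatFun ι) t d coordJ (-1), y⁆ = 0 → y = 0 :=
  fun _ hy hfy => lie_gradedPart_injective (k := RatFun ι) hh hd partialDer partialJ_coordJ hy hfy

theorem exists_isNegSl2 [DecidableEq ι] [FiniteDimensional ℝ g] [LieAlgebra.IsKilling ℝ g]
    (𝒢 : ThreeGrading g) (h𝒢 : 𝒢.space (-1) ≠ ⊥) (ht : ∀ a, t a ∈ 𝒢.space (d a))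
    {h : g} (hh : ∀ a, ⁅h, t a⁆ = (d a : ℝ) • t a) :
    ∃ t0 tp : RatFun ι ⊗[ℝ] g, IsNegSl2 t d 𝒢 t0 tp := by
  have hd := 𝒢.degree_cube ht
  have hJ : ∃ a, d a = -1 ∧ (coordJ a : RatFun ι) ≠ 0 := by
    obtain ⟨y, hy, hy0⟩ := Submodule.exists_mem_ne_zero_of_ne_bot h𝒢
    by_contra! hno
    refine hy0 (t.repr.injective (Finsupp.ext fun a => ?_))
    by_cases ha : d a = -1
    · exact absurd (hno a ha) (ofPoly_ne_zero (MvPolynomial.X_ne_zero a))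
    · simpa using 𝒢.repr_eq_zero ht hy ha
  obtain ⟨t0, ht0, tp, htp, hT, h0K, hpK⟩ := exists_triple (k := RatFun ι) hh
    (lie_tMinus_injective hh hd) hd hJ (negField d) fun a ha => coordJ_mem_negField ⟨a, ha⟩
  refine ⟨t0, tp, ⟨?_, ?_, ?_, fun a => mem_negField.mp (h0K a), fun a => mem_negField.mp (hpK a)⟩⟩
  · rw [tMinus_eq_gradedPart]
    exact hT
  · exact (𝒢.baseChange_space (RatFun ι) ht hh 0).ge ht0
  · exact (𝒢.baseChange_space (RatFun ι) ht hh 1).ge htp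

theorem exists_isHwBasis [FiniteDimensional ℝ g] {tp : RatFun ι ⊗[ℝ] g}
    (htp : HasNegCoeffs t d tp) :
    ∃ (n : ℕ) (ℓ : Fin n → RatFun ι ⊗[ℝ] g), IsHwBasis t d tp ℓ := by
  obtain ⟨n, ℓ, hli, hspan, hℓ⟩ := exists_ker_basis (k := RatFun ι) (t := t) (negField d)
    (x := tp) fun a => mem_negField.mpr (htp a)
  exact ⟨n, ℓ, ⟨hli, hspan, fun s a => mem_negField.mp (hℓ s a)⟩⟩

theorem IsNegSl2.hwSetting [DecidableEq ι] [FiniteDimensional ℝ g] [LieAlgebra.IsKilling ℝ g]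
    {𝒢 : ThreeGrading g} (ht : ∀ a, t a ∈ 𝒢.space (d a))
    {h : g} (hh : ∀ a, ⁅h, t a⁆ = (d a : ℝ) • t a) {t0 tp : RatFun ι ⊗[ℝ] g}
    (hN : IsNegSl2 t d 𝒢 t0 tp) {S : Type*} {ℓ : S → RatFun ι ⊗[ℝ] g} (hℓ : IsHwBasis t d tp ℓ) :
    HwSetting (k := RatFun ι) t d coordJ h (negField d) ((2 : RatFun ι) • t0) tp ℓ where
  lie_basis := hh
  cube := 𝒢.degree_cube ht
  injective := lie_tMinus_injective hh (𝒢.degree_cube ht)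
  coeff_mem a ha := coordJ_mem_negField ⟨a, ha⟩
  triple := by
    have h1 := hN.triple
    rw [tMinus_eq_gradedPart] at h1
    exact h1
  plus_mem := (𝒢.baseChange_space (RatFun ι) ht hh 1).le hN.plus_mem
  plus_coeff a := mem_negField.mpr (hN.plus_coeffs a)
  linearIndependent := hℓ.linearIndependent
  span_eq := hℓ.span_eq
  hw_coeff s a := mem_negField.mpr (hℓ.coeffs s a)

theorem isHwForm_iff {𝒢 : ThreeGrading g} (ht : ∀ a, t a ∈ 𝒢.space (d a))
    {h : g} (hh : ∀ a, ⁅h, t a⁆ = (d a : ℝ) • t a) {S : Type*} [Fintype S]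
    {ℓ : S → RatFun ι ⊗[ℝ] g} {c : RatFun ι ⊗[ℝ] g} {W : S → RatFun ι} :
    IsHwForm t d 𝒢 ℓ c W ↔ c ∈ gradePiece (RatFun ι) ((1 : RatFun ι) ⊗ₜ[ℝ] h) 1 ∧
      conjExp (RatFun ι) c (elementOf t coordJ) =
        gradedPart t d coordJ (-1) + ∑ s, W s • ℓ s := by
  rw [IsHwForm, tMinus_eq_gradedPart]
  exact and_congr (by rw [← 𝒢.baseChange_space (RatFun ι) ht hh 1]) Iff.rfl

end RationalForm

end EnlargedW

end

/-! ### The theorem. -/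

open EnlargedW TensorProduct in
theorem proposition1 {g : Type*} [LieRing g] [LieAlgebra ℝ g] [FiniteDimensional ℝ g]
    [LieAlgebra.IsSimple ℝ g]
    {V : Type*} [AddCommGroup V] [Module ℝ V] [FiniteDimensional ℝ V] [LieRingModule g V]
    [LieModule ℝ g V] (hV : (LieModule.traceForm ℝ g V).Nondegenerate)
    (𝒢 : ThreeGrading g) (h𝒢 : 𝒢.space (-1) ≠ ⊥)
    {ι : Type*} [Fintype ι] [DecidableEq ι] (t : Module.Basis ι ℝ g)
    (d : ι → ℤ) (ht : ∀ a, t a ∈ 𝒢.space (d a)) :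
    (∃ t0 tp : RatFun ι ⊗[ℝ] g, IsNegSl2 t d 𝒢 t0 tp) ∧
    ∀ t0 tp : RatFun ι ⊗[ℝ] g, IsNegSl2 t d 𝒢 t0 tp →
      (∃ (n : ℕ) (ℓ : Fin n → RatFun ι ⊗[ℝ] g), IsHwBasis t d tp ℓ) ∧
      ∀ {S : Type*} [Fintype S] (ℓ : S → RatFun ι ⊗[ℝ] g), IsHwBasis t d tp ℓ →
        (∃! cW : (RatFun ι ⊗[ℝ] g) × (S → RatFun ι), IsHwForm t d 𝒢 ℓ cW.1 cW.2) ∧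
        ∀ (c : RatFun ι ⊗[ℝ] g) (W : S → RatFun ι), IsHwForm t d 𝒢 ℓ c W →
          -- the generators are quotients `P(J_a)/Q(J_α)`
          (∀ s, W s ∈ polyOverNeg d) ∧
          -- the Poisson bracket closes on the functions `P(W_s, J_α)/Q(J_α)`
          (∀ f ∈ wAlgebra d W, ∀ h ∈ wAlgebra d W, poisson V t f h ∈ wAlgebra d W) ∧
          -- these functions are all the `G₊`-invariants
          (wAlgebra d W = {f | ∃ (P : MvPolynomial ι ℝ) (Q : MvPolynomial (Neg d) ℝ),
            IsInvariant t 𝒢 P ∧ Q ≠ 0 ∧ f = ofPoly P / ofNegPoly d Q}) ∧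
          -- the `J_α` belong to the algebra and are central in it
          (∀ α : Neg d, coordJ α.1 ∈ wAlgebra d W ∧
            ∀ f ∈ wAlgebra d W, poisson V t (coordJ α.1) f = 0) := by
  obtain ⟨h, hh⟩ := 𝒢.exists_gradingElement ht
  have hd := 𝒢.degree_cube ht
  have hG : IsGradingElement h := isGradingElement_of_cube hd hh
  refine ⟨exists_isNegSl2 𝒢 h𝒢 ht hh, fun t0 tp hN =>
    ⟨exists_isHwBasis hN.plus_coeffs, fun {S} _ ℓ hℓ => ?_⟩⟩
  have H := hN.hwSetting ht hh hℓ
  refine ⟨?_, fun c W hcW => ?_⟩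
  · obtain ⟨c, hc, W, hW⟩ := H.exists_form
    refine ⟨(c, W), (isHwForm_iff ht hh).mpr ⟨hc, hW⟩, ?_⟩
    rintro ⟨c', W'⟩ hcW'
    obtain ⟨hc', hW'⟩ := (isHwForm_iff ht hh).mp hcW'
    obtain ⟨h1, h2⟩ := H.form_unique hc' hc hW' hW
    exact Prod.ext h1 h2
  obtain ⟨hc, hW⟩ := (isHwForm_iff ht hh).mp hcW
  have hWpoly : ∀ s, W s ∈ polyOverNeg d := fun s => by
    rw [mem_polyOverNeg_iff]
    exact H.form_mem hc hW (wSubalgebra d coordJ) (fun x hx => mem_wAlgebra_of_mem_negField _ hx)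
      (fun a => apply_mem_wAlgebra d coordJ a) s
  have hsub : ∀ f ∈ wAlgebra d W, f ∈ polyOverNeg d := fun f hf => by
    rw [mem_polyOverNeg_iff]
    exact wAlgebra_subset _ (fun s => mem_polyOverNeg_iff.mp (hWpoly s))
      (fun x hx => mem_wAlgebra_of_mem_negField _ hx) hf
  -- The fixed functions form a subalgebra, so it is enough to treat `K` and the `W_s`.
  have hfix : ∀ (x : g) (hx : x ∈ gradePiece ℝ h 1), ∀ f ∈ wAlgebra d W,
      conjFun t hV hG hx f = f := by
    intro x hx f hf
    refine wAlgebra_subset (AlgHom.equalizer (conjFun t hV hG hx).toAlgHom (AlgHom.id ℝ _))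
      (fun s => ?_) (fun z hz => conjFun_of_mem_negField t hV hG hx hh hz) hf
    exact H.algHom_form hc hW hG hx (conjFun t hV hG hx).toAlgHom
      (fun z hz => conjFun_of_mem_negField t hV hG hx hh hz) (conjFun_coordJ t hV hG hx) s
  -- Denominators in the `J_α` are fixed, so invariance passes to the numerator.
  have hinv : ∀ f ∈ polyOverNeg d,
      (∀ (x : g) (hx : x ∈ gradePiece ℝ h 1), conjFun t hV hG hx f = f) →
      ∃ (P : MvPolynomial ι ℝ) (Q : MvPolynomial (Neg d) ℝ),
        IsInvariant t 𝒢 P ∧ Q ≠ 0 ∧ f = ofPoly P / ofNegPoly d Q := by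
    rintro _ ⟨P, Q, hQ, rfl⟩ hfP
    refine ⟨P, Q, ?_, hQ, rfl⟩
    rw [isInvariant_iff t hV hG (𝒢.space_eq_gradePiece ht hh 1)]
    intro x hx
    have h1 := hfP x hx
    rw [map_div₀, conjFun_of_mem_negField t hV hG hx hh (ofNegPoly_mem_negField Q),
      div_left_inj' (ofNegPoly_ne_zero hQ), conjFun_ofPoly] at h1
    exact ofPoly_injective h1
  have heq : wAlgebra d W = {f | ∃ (P : MvPolynomial ι ℝ) (Q : MvPolynomial (Neg d) ℝ),
      IsInvariant t 𝒢 P ∧ Q ≠ 0 ∧ f = ofPoly P / ofNegPoly d Q} := by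
    ext f
    refine ⟨fun hf => hinv f (hsub f hf) fun x hx => hfix x hx f hf, ?_⟩
    rintro ⟨P, Q, hP, hQ, rfl⟩
    rw [div_eq_mul_inv, ofPoly_eq_aeval]
    refine mul_mem (S := Subalgebra ℝ (RatFun ι)) (s := wSubalgebra d W) ?_
      (mem_wAlgebra_of_mem_negField W (inv_mem (ofNegPoly_mem_negField Q)))
    exact H.aeval_mem hc hW ht hP (wSubalgebra d W) (fun x hx => mem_wAlgebra_of_mem_negField W hx)
      (fun s => apply_mem_wAlgebra d W s)
  refine ⟨hWpoly, fun f hf f' hf' => ?_, heq, fun α =>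
    ⟨mem_wAlgebra_of_mem_negField W (coordJ_mem_negField α), fun f hf => ?_⟩⟩
  · rw [heq]
    refine hinv _ (poisson_mem_polyOverNeg t (hsub f hf) (hsub f' hf')) fun x hx => ?_
    rw [← poisson_conjFun, hfix x hx f hf, hfix x hx f' hf']
  · have hu := lowered_mem_gradePiece t hV hh α.1
    rw [α.2, neg_neg] at hu
    -- The `J_α` commute among themselves because their attached elements lie in the Abelian `g₊₁`.
    have hDK : ∀ z ∈ negField d, poissonDer t V (coordJ α.1) z = 0 := fun z hz => by
      refine derivation_eq_zero_of_mem_negField (fun β => ?_) hz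
      have hβ := lowered_mem_gradePiece t hV hh β.1
      rw [β.2, neg_neg] at hβ
      rw [poissonDer_apply, ← linJ_lowered t hV α.1, ← linJ_lowered t hV β.1, poisson_linJ t hV,
        hG.lie_one_one hu hβ, linJ, map_zero]
      exact map_zero _
    rw [← poissonDer_apply]
    exact wAlgebra_subset (kerSubalgebra (poissonDer t V (coordJ α.1)))
      (fun s => H.derivation_form hc hW hu _ hDK (poissonDer_coordJ t hV α.1) s) hDK hf
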